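/- All graphs are finite, in the sense of Serre: a finite set $V(X)$ of vertices, a finite set $H(X)$ of half-edges, a fixed-point-free involution $h\mapsto\bar h$ on $H(X)$ and a root map $r:H(X)\to V(X)$. Edges are the orbits $e=\{h,\bar h\}$; a half-edge $h$ is also an oriented edge from $r(h)$ to $r(\bar h)$. Loops and multiple edges are allowed. The genus of a graph is $g(X)=|E(X)|-|V(X)|+1$, and a tree is a connected graph of genus $0$. The Jacobian polynomial of $X$ is $J_X(x_e)=\sum_T\prod_{e\in E(X)\setminus E(T)}x_e\in\mathbb Z[x_e]_{e\in E(X)}$, the sum being over all spanning trees $T$ of $X$. Let $G$ be a finite abelian group of order $N$ and let $X$ be a connected graph. A harmonic $G$-cover $p:\widetilde X\to X$ is a morphism of graphs (compatible with involutions and root maps) together with an action of $G$ on $\widetilde X$ that does not flip edges and commutes with $p$, and a $G$-invariant local degree function $d_p:V(\widetilde X)\to\mathbb Z_{>0}$, such that: $d_p(\widetilde v)$ is the number of half-edges at $\widetilde v$ over $h$, for every $\widetilde v\in V(\widetilde X)$ and every half-edge $h$ at $p(\widetilde v)$; $\sum_{\widetilde v\in p^{-1}(v)}d_p(\widetilde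 v)=N$ for every $v\in V(X)$; and $G$ acts transitively on the fibers over vertices and freely and transitively on the fibers over half-edges. The dilation group $D(v)\subseteq G$ of $v\in V(X)$ is the subgroup fixing every vertex of $p^{-1}(v)$. The trivial $G$-cover is $X\times G\to X$. Given subgroups $D(v)\subseteq G$ for $v\in V(X)$ and a voltage assignment $\eta:H(X)\to G$ with $\eta(\bar h)=\eta(h)^{-1}$, the associated harmonic $G$-cover has fibers $G/D(v)$ over vertices $v$ and fibers $G$ over oriented edges $h$, and its oriented edge $(h,g)$ goes from $[g]\in G/D(r(h))$ to $[g\,\eta(h)]\in G/D(r(\bar h))$ and has opposite orientation $(\bar h, g\,\eta(h))$. Every harmonic $G$-cover $p:\widetilde X\to X$ with dilation groups $D(v)$ is isomorphic to the cover associated with $D$ and some voltage assignment $\eta$. Fix any such $\eta$. Let $\rho:G\to\mathbb C^*$ be a nontrivial character. Call $F\subseteq E(X)$ independent if, for every connected component $Y$ of $X\setminus F$, the restriction to $Y$ of the $\rho(G)$-cover of $X$ associated with the dilation groups $\rho(D(v))$ and the voltage assignment $\rho(\eta)$ is not isomorphic to the trivial $\rho(G)$-cover. If $\widetilde X$ is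 connected, then these are the independent sets of a matroid $\mathcal M^*(\widetilde X/X,\rho)$ on $E(X)$. In every case call the maximal independent sets bases. The weight of a basis $F$ is $w_\rho(F)=\prod_Y w_\rho(Y)$ over the connected components $Y$ of $X\setminus F$, where $w_\rho(Y)=|1-\rho(\eta(Y))|^2$ if $\rho(D(v))=\{1\}$ for all $v\in V(Y)$ (then $Y$ has genus one, and $\eta(Y)$ is the oriented product of the voltages along its unique cycle), and $w_\rho(Y)=1$ otherwise (then $Y$ is a tree with a unique vertex $v$ such that $\rho(D(v))\ne\{1\}$). The weight polynomial is $$P_{\widetilde X/X,\rho}(x_e)=\sum_{F\text{ basis}}w_\rho(F)\prod_{e\in F}x_e .$$ Let $J_{\widetilde X}(x_e)$ be the polynomial obtained from the Jacobian polynomial of $\widetilde X$ by setting $x_{\widetilde e}=x_{p(\widetilde e)}$ for all $\widetilde e\in E(\widetilde X)$. **Theorem.** For every harmonic $G$-cover $p:\widetilde X\to X$ as above (with $\widetilde X$ connected or not), $$J_{\widetilde X}(x_e)=\frac1N\prod_{v\in V(X)}|D(v)|^{N/|D(v)|}\;J_X(x_e)\prod_{\rho}P_{\widetilde X/X,\rho}(x_e)\quad\text{in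 }\mathbb R[x_e]_{e\in E(X)},$$ where $\rho$ runs over the nontrivial characters of $G$. -/

import Mathlib

universe u v w u₁ u₂

/-- A finite graph in the sense of Serre: finite sets of vertices and half-edges, a
fixed-point-free involution on the half-edges, and a root map.  Loops and multiple edges are
allowed, and connectedness is not part of the definition. -/
structure SerreGraph where
  V : Type u
  H : Type u
  finV : Finite V
  finH : Finite H
  inv : H → H
  inv_inv : ∀ h, inv (inv h) = h
  inv_ne : ∀ h, inv h ≠ h
  root : H → V

namespace SerreGraph

attribute [instance] SerreGraph.finV SerreGraph.finH

/-- Two half-edges are equivalent if they belong to the same orbit of the involution. -/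
def edgeSetoid (X : SerreGraph.{u}) : Setoid X.H where
  r h k := h = k ∨ h = X.inv k
  iseqv := by
    refine ⟨fun h => Or.inl rfl, ?_, ?_⟩
    · rintro h k (rfl | rfl)
      · exact Or.inl rfl
      · exact Or.inr (X.inv_inv k).symm
    · rintro h k l (rfl | rfl) (rfl | rfl)
      · exact Or.inl rfl
      · exact Or.inr rfl
      · exact Or.inr rfl
      · exact Or.inl (X.inv_inv l)

/-- The edges: orbits `{h, inv h}` of the involution. -/
def E (X : SerreGraph.{u}) : Type u := Quotient X.edgeSetoid

/-- The edge containing a half-edge.  A half-edge `h` is also the same thing as an oriented edge,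
with source `root h` and target `root (inv h)`. -/
def edge (X : SerreGraph.{u}) (h : X.H) : X.E := Quotient.mk X.edgeSetoid h

instance (X : SerreGraph.{u}) : Finite X.E := inferInstanceAs (Finite (Quotient X.edgeSetoid))

noncomputable instance (X : SerreGraph.{u}) : Fintype X.V := Fintype.ofFinite _
noncomputable instance (X : SerreGraph.{u}) : Fintype X.E := Fintype.ofFinite _

/-- `u` and `v` are joined by a path in `X` that avoids the edges in `F`. -/
def Joined (X : SerreGraph.{u}) (F : Set X.E) : X.V → X.V → Prop :=
  Relation.ReflTransGen
    fun u v => ∃ h : X.H, X.edge h ∉ F ∧ X.root h = u ∧ X.root (X.inv h) = v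

theorem edge_inv (X : SerreGraph.{u}) (h : X.H) : X.edge (X.inv h) = X.edge h :=
  Quotient.sound (s := X.edgeSetoid) (Or.inr rfl)

/-- A graph is connected if it is non-empty and any two vertices are joined by a path. -/
def Connected (X : SerreGraph.{u}) : Prop := Nonempty X.V ∧ ∀ u v, X.Joined ∅ u v

/-- The genus `|E| - |V| + 1`. -/
noncomputable def genus (X : SerreGraph.{u}) : ℤ := (Nat.card X.E : ℤ) - (Nat.card X.V : ℤ) + 1

/-- A tree is a connected graph of genus zero, that is, with `|E| = |V| - 1`. -/
def IsTree (X : SerreGraph.{u}) : Prop := X.Connected ∧ X.genus = 0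

/-- Subgraphs. -/
structure Subgraph (X : SerreGraph.{u}) where
  verts : Set X.V
  halfs : Set X.H
  inv_mem : ∀ h ∈ halfs, X.inv h ∈ halfs
  root_mem : ∀ h ∈ halfs, X.root h ∈ verts

/-- A subgraph as a graph in its own right. -/
def Subgraph.toGraph {X : SerreGraph.{u}} (Y : X.Subgraph) : SerreGraph.{u} where
  V := Y.verts
  H := Y.halfs
  finV := inferInstance
  finH := inferInstance
  inv h := ⟨X.inv h.1, Y.inv_mem h.1 h.2⟩
  inv_inv h := Subtype.ext (X.inv_inv h.1)
  inv_ne h hh := X.inv_ne h.1 (congrArg Subtype.val hh)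
  root h := ⟨X.root h.1, Y.root_mem h.1 h.2⟩

/-- The spanning subgraph with all the vertices and with edge set `T`. -/
def spanning (X : SerreGraph.{u}) (T : Set X.E) : X.Subgraph where
  verts := Set.univ
  halfs := {h | X.edge h ∈ T}
  inv_mem h hh := by
    show X.edge (X.inv h) ∈ T
    rw [X.edge_inv]
    exact hh
  root_mem _ _ := Set.mem_univ _

open Classical in
/-- The Jacobian polynomial: the sum over the spanning trees `T` of the products of the variables
of the edges that are not in `T`. -/
noncomputable def jacobianPoly (X : SerreGraph.{u}) : MvPolynomial X.E ℤ :=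
  ∑ T ∈ Finset.filter (fun T : Finset X.E => (X.spanning (T : Set X.E)).toGraph.IsTree)
      (Finset.univ : Finset (Finset X.E)),
    ∏ e ∈ Tᶜ, (MvPolynomial.X e : MvPolynomial X.E ℤ)

/-- Being joined outside `F` is an equivalence relation. -/
def joinedSetoid (X : SerreGraph.{u}) (F : Set X.E) : Setoid X.V where
  r := X.Joined F
  iseqv := by
    refine ⟨fun _ => Relation.ReflTransGen.refl, ?_, fun h k => h.trans k⟩
    intro a b hab
    induction hab with
    | refl => exact Relation.ReflTransGen.refl
    | tail _ hbc ih =>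
      obtain ⟨h, hF, h1, h2⟩ := hbc
      refine Relation.ReflTransGen.head ⟨X.inv h, ?_, h2, ?_⟩ ih
      · rwa [X.edge_inv]
      · rw [X.inv_inv, h1]

/-- The set of connected components of `X \ F` (all vertices of `X`, and the edges of `X` that are
not in `F`). -/
def Component (X : SerreGraph.{u}) (F : Set X.E) : Type u := Quotient (X.joinedSetoid F)

instance (X : SerreGraph.{u}) (F : Set X.E) : Finite (X.Component F) :=
  inferInstanceAs (Finite (Quotient (X.joinedSetoid F)))

noncomputable instance (X : SerreGraph.{u}) (F : Set X.E) : Fintype (X.Component F) :=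
  Fintype.ofFinite _

/-- The component of `X \ F` that contains a given vertex. -/
def component (X : SerreGraph.{u}) (F : Set X.E) (v : X.V) : X.Component F :=
  Quotient.mk (X.joinedSetoid F) v

/-- A connected component of `X \ F` as a subgraph of `X`. -/
def Component.subgraph {X : SerreGraph.{u}} {F : Set X.E} (C : X.Component F) : X.Subgraph where
  verts := {v | X.component F v = C}
  halfs := {h | X.edge h ∉ F ∧ X.component F (X.root h) = C}
  inv_mem h hh := by
    refine ⟨by rw [X.edge_inv]; exact hh.1, ?_⟩
    rw [← hh.2]
    refine Quotient.sound (s := X.joinedSetoid F) ?_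
    refine Relation.ReflTransGen.single ⟨X.inv h, ?_, rfl, ?_⟩
    · rw [X.edge_inv]; exact hh.1
    · rw [X.inv_inv]
  root_mem _ hh := hh.2

/-- Morphisms of graphs. -/
structure Hom (X : SerreGraph.{u}) (Y : SerreGraph.{v}) where
  onV : X.V → Y.V
  onH : X.H → Y.H
  map_inv : ∀ h, onH (X.inv h) = Y.inv (onH h)
  map_root : ∀ h, onV (X.root h) = Y.root (onH h)

/-- The map induced on edges by a morphism. -/
def Hom.onE {X : SerreGraph.{u}} {Y : SerreGraph.{v}} (f : X.Hom Y) : X.E → Y.E :=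
  Quotient.map' (s₁ := X.edgeSetoid) (s₂ := Y.edgeSetoid) f.onH (by
    rintro a b (rfl | rfl)
    · exact Or.inl rfl
    · exact Or.inr (f.map_inv b))

/-- A left action of a group on a graph by automorphisms that do not flip edges. -/
structure Action (G : Type w) [Group G] (X : SerreGraph.{u}) where
  actV : G → X.V → X.V
  actH : G → X.H → X.H
  one_actV : ∀ x, actV 1 x = x
  mul_actV : ∀ a b x, actV (a * b) x = actV a (actV b x)
  one_actH : ∀ h, actH 1 h = h
  mul_actH : ∀ a b h, actH (a * b) h = actH a (actH b h)
  act_inv : ∀ g h, actH g (X.inv h) = X.inv (actH g h)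
  act_root : ∀ g h, actV g (X.root h) = X.root (actH g h)
  no_flip : ∀ g h, actH g h ≠ X.inv h

/-- A harmonic `G`-cover (Galois cover with group `G`): a harmonic morphism `X' → X` of degree
`|G|`, with local degree function `deg`, and a `G`-action on `X'` that commutes with the morphism,
preserves `deg`, is transitive on the fibers over vertices, and is free and transitive on the
fibers over half-edges. -/
structure GCover (G : Type w) [Group G] (X' : SerreGraph.{v}) (X : SerreGraph.{u}) extends
    Hom X' X, Action G X' where
  deg : X'.V → ℕ
  deg_pos : ∀ x, 0 < deg x
  balancing : ∀ (x : X'.V) (h : X.H), X.root h = onV x →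
    deg x = Nat.card {k : X'.H // X'.root k = x ∧ onH k = h}
  degree : ∀ y : X.V, ∑ᶠ x : {x : X'.V // onV x = y}, deg x.1 = Nat.card G
  equivariantV : ∀ g x, onV (actV g x) = onV x
  equivariantH : ∀ g h, onH (actH g h) = onH h
  deg_act : ∀ g x, deg (actV g x) = deg x
  transitiveV : ∀ x y, onV x = onV y → ∃ g, actV g x = y
  transitiveH : ∀ h k, onH h = onH k → ∃ g, actH g h = k
  freeH : ∀ g h, actH g h = h → g = 1

namespace GCover

/-- An isomorphism of `G`-covers of `X`: a `G`-equivariant isomorphism of graphs over `X`. -/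
structure Iso {G : Type w} [Group G] {X₁ : SerreGraph.{u₁}} {X₂ : SerreGraph.{u₂}}
    {X : SerreGraph.{u}} (p : GCover G X₁ X) (q : GCover G X₂ X) where
  eV : X₁.V ≃ X₂.V
  eH : X₁.H ≃ X₂.H
  map_inv : ∀ h, eH (X₁.inv h) = X₂.inv (eH h)
  map_root : ∀ h, eV (X₁.root h) = X₂.root (eH h)
  mapV : ∀ g x, eV (p.actV g x) = q.actV g (eV x)
  mapH : ∀ g h, eH (p.actH g h) = q.actH g (eH h)
  overV : ∀ x, q.onV (eV x) = p.onV x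
  overH : ∀ h, q.onH (eH h) = p.onH h

/-- The dilation subgroup of a vertex of the base. -/
def dilation {G : Type w} [Group G] {X' : SerreGraph.{v}} {X : SerreGraph.{u}}
    (p : GCover G X' X) (y : X.V) : Subgroup G where
  carrier := {g | ∀ x, p.onV x = y → p.actV g x = x}
  one_mem' := fun x _ => p.one_actV x
  mul_mem' := by
    intro a b ha hb x hx
    rw [p.mul_actV, hb x hx, ha x hx]
  inv_mem' := by
    intro a ha x hx
    have h1 := congrArg (p.actV a⁻¹) (ha x hx)
    rw [← p.mul_actV, inv_mul_cancel, p.one_actV] at h1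
    exact h1.symm

/-- The full preimage of a subgraph of the base. -/
def preimage {G : Type w} [Group G] {X' : SerreGraph.{v}} {X : SerreGraph.{u}}
    (p : GCover G X' X) (Y : X.Subgraph) : X'.Subgraph where
  verts := {x | p.onV x ∈ Y.verts}
  halfs := {h | p.onH h ∈ Y.halfs}
  inv_mem h hh := by
    show p.onH (X'.inv h) ∈ Y.halfs
    rw [p.map_inv]
    exact Y.inv_mem _ hh
  root_mem h hh := by
    show p.onV (X'.root h) ∈ Y.verts
    rw [p.map_root]
    exact Y.root_mem _ hh

/-- The restriction of a `G`-cover to a subgraph of the base. -/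
def restrict {G : Type w} [Group G] {X' : SerreGraph.{v}} {X : SerreGraph.{u}}
    (p : GCover G X' X) (Y : X.Subgraph) : GCover G (p.preimage Y).toGraph Y.toGraph where
  onV x := ⟨p.onV x.1, x.2⟩
  onH h := ⟨p.onH h.1, h.2⟩
  map_inv h := Subtype.ext (p.map_inv h.1)
  map_root h := Subtype.ext (p.map_root h.1)
  actV g x := ⟨p.actV g x.1, by
    show p.onV _ ∈ Y.verts
    rw [p.equivariantV]
    exact x.2⟩
  actH g h := ⟨p.actH g h.1, by
    show p.onH _ ∈ Y.halfs
    rw [p.equivariantH]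
    exact h.2⟩
  one_actV x := Subtype.ext (p.one_actV x.1)
  mul_actV a b x := Subtype.ext (p.mul_actV a b x.1)
  one_actH h := Subtype.ext (p.one_actH h.1)
  mul_actH a b h := Subtype.ext (p.mul_actH a b h.1)
  act_inv g h := Subtype.ext (p.act_inv g h.1)
  act_root g h := Subtype.ext (p.act_root g h.1)
  no_flip g h hh := p.no_flip g h.1 (congrArg Subtype.val hh)
  deg x := p.deg x.1
  deg_pos x := p.deg_pos x.1
  balancing x h hx := by
    rw [p.balancing x.1 h.1 (congrArg Subtype.val hx)]
    refine Nat.card_congr ⟨fun k => ⟨⟨k.1, ?_⟩, ?_, ?_⟩, fun k => ⟨k.1.1, ?_, ?_⟩, ?_, ?_⟩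
    · show p.onH k.1 ∈ Y.halfs
      rw [k.2.2]
      exact h.2
    · exact Subtype.ext k.2.1
    · exact Subtype.ext k.2.2
    · exact congrArg Subtype.val k.2.1
    · exact congrArg Subtype.val k.2.2
    · intro k; rfl
    · intro k; rfl
  degree y := by
    rw [← p.degree y.1]
    refine finsum_eq_of_bijective
      (fun x => (⟨x.1.1, congrArg Subtype.val x.2⟩ : {x : X'.V // p.onV x = y.1})) ⟨?_, ?_⟩ ?_
    · intro a b hab
      exact Subtype.ext (Subtype.ext (congrArg (fun z => z.1) hab))
    · intro b
      refine ⟨⟨⟨b.1, ?_⟩, ?_⟩, rfl⟩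
      · show p.onV b.1 ∈ Y.verts
        rw [b.2]
        exact y.2
      · exact Subtype.ext b.2
    · intro x; rfl
  equivariantV g x := Subtype.ext (p.equivariantV g x.1)
  equivariantH g h := Subtype.ext (p.equivariantH g h.1)
  deg_act g x := p.deg_act g x.1
  transitiveV x y hxy := by
    obtain ⟨g, hg⟩ := p.transitiveV x.1 y.1 (congrArg Subtype.val hxy)
    exact ⟨g, Subtype.ext hg⟩
  transitiveH x y hxy := by
    obtain ⟨g, hg⟩ := p.transitiveH x.1 y.1 (congrArg Subtype.val hxy)
    exact ⟨g, Subtype.ext hg⟩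
  freeH g h hh := p.freeH g h.1 (congrArg Subtype.val hh)

end GCover

/-- A `G`-voltage assignment, as a function on oriented edges (half-edges) that changes to its
inverse when the orientation is reversed. -/
def IsVoltage {G : Type w} [Group G] (X : SerreGraph.{u}) (η : X.H → G) : Prop :=
  ∀ h, η (X.inv h) = (η h)⁻¹

/-- The total space of the cover with dilation groups `D` and voltage assignment `η`.  The fiber
over a vertex `v` is `G ⧸ D v` and the fiber over an oriented edge is `G`; the oriented edge
`(h, g)` has source `(root h, [g])` and target `(root (inv h), [g * η h])`. -/
def coverGraph {G : Type w} [CommGroup G] [Finite G] (X : SerreGraph.{u})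
    (D : X.V → Subgroup G) (η : X.H → G) (hη : X.IsVoltage η) : SerreGraph.{max u w} where
  V := Σ v : X.V, G ⧸ D v
  H := X.H × G
  finV := inferInstance
  finH := inferInstance
  inv k := (X.inv k.1, k.2 * η k.1)
  inv_inv k := by
    refine Prod.ext (X.inv_inv k.1) ?_
    show k.2 * η k.1 * η (X.inv k.1) = k.2
    rw [hη, mul_inv_cancel_right]
  inv_ne k hk := X.inv_ne k.1 (congrArg Prod.fst hk)
  root k := ⟨X.root k.1, (k.2 : G ⧸ D (X.root k.1))⟩

/-- The harmonic `G`-cover of `X` with dilation groups `D` and voltage assignment `η`. -/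
noncomputable def voltageCover {G : Type w} [CommGroup G] [Finite G] (X : SerreGraph.{u})
    (D : X.V → Subgroup G) (η : X.H → G) (hη : X.IsVoltage η) :
    GCover G (X.coverGraph D η hη) X where
  onV x := x.1
  onH k := k.1
  map_inv _ := rfl
  map_root _ := rfl
  actV g x := ⟨x.1, g • x.2⟩
  actH g k := (k.1, g * k.2)
  one_actV x := Sigma.ext rfl (heq_of_eq (one_smul G x.2))
  mul_actV a b x := by rw [mul_smul]
  one_actH k := Prod.ext rfl (one_mul k.2)
  mul_actH a b k := by rw [mul_assoc]
  act_inv g k := Prod.ext rfl (mul_assoc g k.2 (η k.1)).symm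
  act_root _ _ := rfl
  no_flip _ k hk := X.inv_ne k.1 (congrArg Prod.fst hk).symm
  deg x := Nat.card (D x.1)
  deg_pos _ := Nat.card_pos
  balancing := by
    rintro ⟨y, x⟩ h rfl
    obtain ⟨a, rfl⟩ := QuotientGroup.mk_surjective x
    refine Nat.card_congr (Equiv.ofBijective (fun d => ⟨(h, a * d.1), ?_, rfl⟩) ⟨?_, ?_⟩)
    · refine Sigma.ext rfl (heq_of_eq ?_)
      exact QuotientGroup.mk_mul_of_mem a d.2
    · intro d e hde
      have h1 : a * d.1 = a * e.1 := congrArg (fun z => z.1.2) hde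
      exact Subtype.ext (mul_left_cancel h1)
    · rintro ⟨⟨k, b⟩, hk, rfl⟩
      have h1 : (a : G ⧸ D (X.root k)) = b := (eq_of_heq (Sigma.ext_iff.1 hk).2).symm
      refine ⟨⟨a⁻¹ * b, QuotientGroup.eq.1 h1⟩, ?_⟩
      exact Subtype.ext (Prod.ext rfl (mul_inv_cancel_left a b))
  degree y := by
    have e : {x : Σ v : X.V, G ⧸ D v // x.1 = y} ≃ G ⧸ D y := Equiv.sigmaSubtype y
    have h1 : ∀ x : {x : Σ v : X.V, G ⧸ D v // x.1 = y}, Nat.card (D x.1.1) = Nat.card (D y) :=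
      fun x => by rw [x.2]
    show ∑ᶠ x : {x : Σ v : X.V, G ⧸ D v // x.1 = y}, Nat.card (D x.1.1) = Nat.card G
    rw [finsum_congr h1]
    have := Fintype.ofFinite {x : Σ v : X.V, G ⧸ D v // x.1 = y}
    rw [finsum_eq_sum_of_fintype, Finset.sum_const, Finset.card_univ, ← Nat.card_eq_fintype_card,
      Nat.card_congr e, smul_eq_mul, ← Subgroup.card_eq_card_quotient_mul_card_subgroup]
  equivariantV _ _ := rfl
  equivariantH _ _ := rfl
  deg_act _ _ := rfl
  transitiveV := by
    rintro ⟨y, x⟩ ⟨y', x'⟩ (rfl : y = y')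
    obtain ⟨g, hg⟩ := MulAction.exists_smul_eq G x x'
    exact ⟨g, by rw [hg]⟩
  transitiveH := by
    rintro ⟨h, a⟩ ⟨h', b⟩ (rfl : h = h')
    exact ⟨b * a⁻¹, Prod.ext rfl (inv_mul_cancel_right b a)⟩
  freeH g k hk := mul_eq_right.1 (congrArg Prod.snd hk)

/-- The total space `X × G` of the trivial `G`-cover. -/
def trivialGraph (G : Type w) [Finite G] (X : SerreGraph.{u}) : SerreGraph.{max u w} where
  V := X.V × G
  H := X.H × G
  finV := inferInstance
  finH := inferInstance
  inv k := (X.inv k.1, k.2)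
  inv_inv k := Prod.ext (X.inv_inv k.1) rfl
  inv_ne k hk := X.inv_ne k.1 (congrArg Prod.fst hk)
  root k := (X.root k.1, k.2)

/-- The trivial `G`-cover `X × G → X`. -/
def trivialCover (G : Type w) [Group G] [Finite G] (X : SerreGraph.{u}) :
    GCover G (trivialGraph G X) X where
  onV x := x.1
  onH k := k.1
  map_inv _ := rfl
  map_root _ := rfl
  actV g x := (x.1, g * x.2)
  actH g k := (k.1, g * k.2)
  one_actV x := Prod.ext rfl (one_mul x.2)
  mul_actV a b x := by rw [mul_assoc]
  one_actH k := Prod.ext rfl (one_mul k.2)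
  mul_actH a b k := by rw [mul_assoc]
  act_inv _ _ := rfl
  act_root _ _ := rfl
  no_flip _ k hk := X.inv_ne k.1 (congrArg Prod.fst hk).symm
  deg _ := 1
  deg_pos _ := one_pos
  balancing := by
    rintro ⟨y, a⟩ h rfl
    refine (Nat.card_eq_one_iff_exists.2 ⟨⟨(h, a), rfl, rfl⟩, ?_⟩).symm
    rintro ⟨⟨k, b⟩, hk, rfl⟩
    have h1 : b = a := congrArg (fun z : X.V × G => z.2) hk
    exact Subtype.ext (Prod.ext rfl h1)
  degree y := by
    let e : {x : X.V × G // x.1 = y} ≃ G :=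
      ⟨fun x => x.1.2, fun g => ⟨(y, g), rfl⟩, by rintro ⟨⟨a, b⟩, rfl⟩; rfl, fun _ => rfl⟩
    show ∑ᶠ x : {x : X.V × G // x.1 = y}, 1 = Nat.card G
    have := Fintype.ofFinite {x : X.V × G // x.1 = y}
    rw [finsum_eq_sum_of_fintype, Finset.sum_const, Finset.card_univ, ← Nat.card_eq_fintype_card,
      Nat.card_congr e, smul_eq_mul, mul_one]
  equivariantV _ _ := rfl
  equivariantH _ _ := rfl
  deg_act _ _ := rfl
  transitiveV := by
    rintro ⟨h, a⟩ ⟨h', b⟩ (rfl : h = h')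
    exact ⟨b * a⁻¹, Prod.ext rfl (inv_mul_cancel_right b a)⟩
  transitiveH := by
    rintro ⟨h, a⟩ ⟨h', b⟩ (rfl : h = h')
    exact ⟨b * a⁻¹, Prod.ext rfl (inv_mul_cancel_right b a)⟩
  freeH g k hk := mul_eq_right.1 (congrArg Prod.snd hk)

/-- A subgraph `Y` of the base is `G`-nontrivial if the restriction of the cover to `Y` is not
isomorphic to the trivial `G`-cover of `Y`. -/
def GCover.IsNontrivialOn {G : Type w} [Group G] [Finite G] {X' : SerreGraph.{v}}
    {X : SerreGraph.{u}} (p : GCover G X' X) (Y : X.Subgraph) : Prop :=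
  IsEmpty ((p.restrict Y).Iso (trivialCover G Y.toGraph))

/-- The independent sets of the matroid of a cover: sets `F` of edges of the base such that every
connected component of `X \ F` is `G`-nontrivial. -/
def GCover.Indep {G : Type w} [Group G] [Finite G] {X' : SerreGraph.{v}}
    {X : SerreGraph.{u}} (p : GCover G X' X) (F : Set X.E) : Prop :=
  ∀ C : X.Component F, p.IsNontrivialOn C.subgraph

/-- The cover `p` is the one defined by the voltage assignment `η` (together with the dilation
groups of `p`), up to isomorphism. -/
def GCover.HasVoltage {G : Type w} [CommGroup G] [Finite G] {X' : SerreGraph.{v}}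
    {X : SerreGraph.{u}} (p : GCover G X' X) (η : X.H → G) (hη : X.IsVoltage η) : Prop :=
  Nonempty (p.Iso (X.voltageCover p.dilation η hη))

section Twist

variable {G : Type w} [CommGroup G] (X : SerreGraph.{u}) (D : X.V → Subgroup G)
  (ρ : G →* ℂˣ) (η : X.H → G)

instance finite_range_character [Finite G] : Finite ρ.range :=
  inferInstanceAs (Finite (Set.range ρ))

theorem isVoltage_twist (hη : X.IsVoltage η) :
    X.IsVoltage (fun h => ρ.rangeRestrict (η h)) := by
  intro h
  show ρ.rangeRestrict (η (X.inv h)) = (ρ.rangeRestrict (η h))⁻¹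
  rw [hη, map_inv]

/-- The `ρ(G)`-cover of `X` with dilation groups `ρ(D v)` and voltage assignment `ρ(η)`. -/
noncomputable def twistedCover [Finite G] (hη : X.IsVoltage η) :
    GCover ρ.range (X.coverGraph (fun v => (D v).map ρ.rangeRestrict)
      (fun h => ρ.rangeRestrict (η h)) (X.isVoltage_twist ρ η hη)) X :=
  X.voltageCover (fun v => (D v).map ρ.rangeRestrict) (fun h => ρ.rangeRestrict (η h))
    (X.isVoltage_twist ρ η hη)

/-- The independent sets of the twisted matroid: the sets `F` of edges such that the `ρ(G)`-cover
is nontrivial on each connected component of `X \ F`. -/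
def TwistedIndep [Finite G] (hη : X.IsVoltage η) (F : Set X.E) : Prop :=
  (X.twistedCover D ρ η hη).Indep F

/-- The bases of the twisted matroid: the maximal independent sets. -/
def TwistedBasis [Finite G] (hη : X.IsVoltage η) (F : Set X.E) : Prop :=
  Maximal (X.TwistedIndep D ρ η hη) F

/-- `a` is the oriented product of the voltages along a simple cycle of `Y`: a closed chain of
oriented edges of `Y` with distinct sources and distinct underlying edges.  The index `i + 1` is
taken cyclically. -/
def IsCycleVoltage (Y : X.Subgraph) (a : G) : Prop :=
  ∃ (n : ℕ) (c : Fin (n + 1) → X.H),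
    (∀ i, c i ∈ Y.halfs) ∧
    (∀ i, X.root (X.inv (c i)) = X.root (c (i + 1))) ∧
    Function.Injective (fun i => X.root (c i)) ∧
    Function.Injective (fun i => X.edge (c i)) ∧
    a = ∏ i, η (c i)

open Classical in
/-- The Frobenius element of a subgraph with a unique cycle: the voltage along that cycle.  It is
determined up to inversion (choice of the direction of the cycle).  The value is `1` if there is
no cycle. -/
noncomputable def frobenius (Y : X.Subgraph) : G :=
  if h : ∃ a, X.IsCycleVoltage η Y a then h.choose else 1

open Classical in
/-- The weight of a connected component of the complement of a basis.  If `ρ(D v)` is trivial for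
all vertices (so that the component has genus one), it is `|1 - ρ(η(Y))|²`; otherwise the
component is a tree with a unique vertex for which `ρ(D v)` is not trivial, and it is `1`. -/
noncomputable def componentWeight (Y : X.Subgraph) : ℝ :=
  if ∀ v ∈ Y.verts, (D v).map ρ = ⊥ then ‖(1 : ℂ) - (ρ (X.frobenius η Y) : ℂ)‖ ^ 2 else 1

/-- The weight of a basis: the product of the weights of the components of `X \ F`. -/
noncomputable def basisWeight (F : Set X.E) : ℝ :=
  ∏ C : X.Component F, X.componentWeight D ρ η C.subgraph

open Classical in
/-- The weight polynomial of the twisted matroid. -/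
noncomputable def weightPoly [Finite G] (hη : X.IsVoltage η) : MvPolynomial X.E ℝ :=
  ∑ F ∈ Finset.filter (fun F : Finset X.E => X.TwistedBasis D ρ η hη (F : Set X.E))
      (Finset.univ : Finset (Finset X.E)),
    MvPolynomial.C (X.basisWeight D ρ η (F : Set X.E)) *
      ∏ e ∈ F, (MvPolynomial.X e : MvPolynomial X.E ℝ)

end Twist

/-- The Jacobian polynomial of the total space, specialized by giving each edge the variable of
its image in the base. -/
noncomputable def GCover.specializedJacobian {G : Type w} [Group G] {X' : SerreGraph.{v}}
    {X : SerreGraph.{u}} (p : GCover G X' X) : MvPolynomial X.E ℤ :=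
  MvPolynomial.rename p.toHom.onE X'.jacobianPoly

open Classical in
/-- The set of nontrivial complex characters of a finite group. -/
noncomputable def nontrivialCharacters (G : Type w) [CommGroup G] [Finite G] :
    Finset (G →* ℂˣ) :=
  letI : Fintype (G →* ℂˣ) := Fintype.ofFinite _
  Finset.univ.filter (fun ρ => ρ ≠ 1)

end SerreGraph

/-! The Laplacian of the cover, with conductances pulled back from the base, commutes with the
action of `G` and decomposes into one block for each character `ρ` of `G`.  The block of `ρ` acts on
functions on the vertices `v` such that `ρ` is trivial on `D(v)`, and it is `|D(v)|` times a
restriction of the Laplacian of `X` twisted by `ρ(η)` (`coverLaplacian_mul_fourierMatrix`).  The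
factorization of the Jacobian polynomial is the resulting factorization of a determinant, at
conductances `1 / x_e`; polynomials that agree at all points with nonzero coordinates are equal.

*Spanning trees.*  The Laplacian is singular, so it is perturbed by the rank one matrix `m mᵀ` of a
positive mass function `m` on the vertices; the determinant is then the square of the total mass
times the weighted count of spanning trees (`det_laplacian_add`).  On the cover the mass is
`m(x) = |D(p(x))|`: it is orthogonal to all nontrivial characters, so the perturbation affects only
the block of the trivial character, where the mass becomes constant.  This makes the proof uniform
in connected and disconnected covers.

*Nontrivial characters.*  The Laplacian is `Δᴴ diag(y) Δ` for the twisted coboundary matrix `Δ`,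
so Cauchy–Binet (`Matrix.det_conjTranspose_mul_diagonal_mul`) expands the block of `ρ` as a sum over
the square submatrices of `Δ`, obtained by deleting the rows in a set `F` of edges and the columns
of the vertices `v` at which `ρ` is nontrivial on `D(v)`.  The set `F` is independent if and only if
there is no nonzero `ρ(η)`-flat function on `X \ F` that vanishes at these vertices
(`twistedIndep_iff`), that is, if and only if the remaining rows span.  Hence independence is that of
the dual of a linear matroid (`exists_matroid_twistedIndep`), the bases are the sets `F` with a
nonzero minor, and it remains to see that the squared modulus of that minor is the weight of `F`
(`basisWeight_eq`).  For a basis `F`, each component of `X \ F`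
without dilated vertices has a unique simple cycle; removing an edge
from each cycle leaves a forest on which the gains can be removed by a gauge transformation of
modulus one (`exists_gauge`).  The minor then is unimodular times a diagonal block with one entry
`1 - ρ(η(Y))` for each of these components (`absDet_coboundaryOn`). -/

/-! ### Absolute determinants and the Cauchy–Binet formula -/

section LinearAlgebra

open Matrix

open Classical in
/-- The absolute value of the determinant of a complex matrix whose rows and columns are indexed
by different types; it is `0` if the matrix is not square.  The bijection between the index
types that is used affects only the sign of the determinant. -/
noncomputable def Matrix.absDet {m : Type*} {n : Type*} [Finite n] (M : Matrix m n ℂ) : ℝ :=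
  letI := Fintype.ofFinite n
  if h : Nonempty (n ≃ m) then ‖(M.submatrix h.some id).det‖ else 0

theorem Matrix.norm_det_submatrix_equiv {m n : Type*} [Fintype n] [DecidableEq n]
    (M : Matrix m n ℂ) (e e' : n ≃ m) :
    ‖(M.submatrix e' id).det‖ = ‖(M.submatrix e id).det‖ := by
  have h1 : M.submatrix e' id = (M.submatrix e id).submatrix (e'.trans e.symm) id := by
    ext i j
    simp
  rw [h1, Matrix.det_permute, norm_mul]
  have h2 : ‖((Equiv.Perm.sign (e'.trans e.symm) : ℤ) : ℂ)‖ = 1 := by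
    rcases Int.units_eq_one_or (Equiv.Perm.sign (e'.trans e.symm)) with h | h <;> simp [h]
  rw [h2, one_mul]

theorem Matrix.absDet_eq {m n : Type*} [Finite n] [Fintype n] [DecidableEq n]
    (M : Matrix m n ℂ) (e : n ≃ m) : M.absDet = ‖(M.submatrix e id).det‖ := by
  have h : Nonempty (n ≃ m) := ⟨e⟩
  rw [Matrix.absDet, dif_pos h, ← Matrix.norm_det_submatrix_equiv M e h.some]
  congr!

theorem Matrix.absDet_of_isEmpty {m n : Type*} [Finite n] (M : Matrix m n ℂ)
    (h : IsEmpty (n ≃ m)) : M.absDet = 0 :=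
  dif_neg (not_nonempty_iff.2 h)

theorem Matrix.absDet_submatrix {m n m' n' : Type*} [Finite n] [Finite n']
    (M : Matrix m n ℂ) (e : m' ≃ m) (f : n' ≃ n) : (M.submatrix e f).absDet = M.absDet := by
  classical
  have := Fintype.ofFinite n
  have := Fintype.ofFinite n'
  by_cases h : Nonempty (n ≃ m)
  · obtain ⟨a⟩ := h
    rw [Matrix.absDet_eq M a, Matrix.absDet_eq _ ((f.trans a).trans e.symm),
      ← Matrix.det_submatrix_equiv_self f (M.submatrix a id)]
    congr 2
    ext i j
    simp
  · rw [Matrix.absDet_of_isEmpty M (not_nonempty_iff.1 h), Matrix.absDet_of_isEmpty]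
    exact ⟨fun a => h ⟨(f.symm.trans a).trans e⟩⟩

/-- A square matrix has nonzero determinant if and only if it is injective on vectors. -/
theorem Matrix.absDet_ne_zero_iff {m n : Type*} [Fintype n] (M : Matrix m n ℂ) :
    M.absDet ≠ 0 ↔ Nonempty (n ≃ m) ∧ ∀ f : n → ℂ, M *ᵥ f = 0 → f = 0 := by
  classical
  by_cases h : Nonempty (n ≃ m)
  · obtain ⟨a⟩ := h
    rw [Matrix.absDet_eq M a, norm_ne_zero_iff, Ne, ← Matrix.exists_mulVec_eq_zero_iff]
    have key : ∀ f : n → ℂ, M.submatrix a id *ᵥ f = 0 ↔ M *ᵥ f = 0 := by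
      intro f
      constructor
      · intro h
        funext i
        have := congrFun h (a.symm i)
        simpa [Matrix.mulVec, dotProduct] using this
      · intro h
        funext i
        exact congrFun h (a i)
    constructor
    · intro h
      refine ⟨⟨a⟩, fun f hf => ?_⟩
      by_contra h0
      exact h ⟨f, h0, (key f).2 hf⟩
    · rintro ⟨-, h⟩ ⟨f, h0, hf⟩
      exact h0 (h f ((key f).1 hf))
  · rw [Matrix.absDet_of_isEmpty M (not_nonempty_iff.1 h)]
    simp [h]

/-- The absolute determinant of a block matrix `[A, B; C, D]` with `A` square in which column
operations clear the block `B`. -/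
theorem Matrix.absDet_fromBlocks {p q l : Type*} [Fintype q] [Fintype l] [DecidableEq l]
    (A : Matrix p q ℂ) (B : Matrix p l ℂ) (C : Matrix l q ℂ) (D : Matrix l l ℂ)
    (hpq : Nonempty (q ≃ p)) (g : Matrix q l ℂ) (hg : A * g + B = 0) :
    (Matrix.fromBlocks A B C D).absDet = A.absDet * ‖(C * g + D).det‖ := by
  classical
  obtain ⟨e⟩ := hpq
  rw [Matrix.absDet_eq A e, Matrix.absDet_eq _ (Equiv.sumCongr e (Equiv.refl l)), ← norm_mul]
  have h1 : (Matrix.fromBlocks A B C D).submatrix (Equiv.sumCongr e (Equiv.refl l)) id =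
      Matrix.fromBlocks (A.submatrix e id) (B.submatrix e id) C D := by
    ext (i | i) (j | j) <;> rfl
  have h2 : Matrix.fromBlocks (A.submatrix e id) (B.submatrix e id) C D *
      Matrix.fromBlocks 1 g 0 1 =
      Matrix.fromBlocks (A.submatrix e id) 0 C (C * g + D) := by
    rw [Matrix.fromBlocks_multiply]
    have h3 : A.submatrix e id * g + B.submatrix e id = 0 := by
      ext i j
      exact congrFun (congrFun hg (e i)) j
    simp [h3]
  have h4 := congrArg Matrix.det h2
  rw [Matrix.det_mul, Matrix.det_fromBlocks_zero₂₁, Matrix.det_one, Matrix.det_one,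
    Matrix.det_fromBlocks_zero₁₂, mul_one, mul_one] at h4
  rw [h1, h4]

theorem Matrix.det_mul_eq_sum_functions {m n R : Type*} [CommRing R] [Fintype m] [Fintype n]
    [DecidableEq n] (A : Matrix n m R) (B : Matrix m n R) :
    (A * B).det = ∑ f : n → m, (∏ i, A i (f i)) * (B.submatrix f id).det := by
  classical
  have h1 : (A * B) = fun i => ∑ j, A i j • B j := by
    ext i k
    simp [Matrix.mul_apply, Finset.sum_apply]
  rw [h1]
  change (Matrix.detRowAlternating (R := R) (n := n)).toMultilinearMap _ = _
  rw [MultilinearMap.map_sum]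
  refine Finset.sum_congr rfl fun f _ => ?_
  rw [MultilinearMap.map_smul_univ]
  rfl

/-- The Cauchy–Binet formula for a product `Nᴴ * diag y * N`. -/
theorem Matrix.det_conjTranspose_mul_diagonal_mul {m n : Type*} [Fintype m] [Fintype n]
    [DecidableEq m] [DecidableEq n] (N : Matrix m n ℂ) (y : m → ℂ) :
    (Nᴴ * Matrix.diagonal y * N).det =
      ∑ S : Finset m, (∏ e ∈ S, y e) *
        (((N.submatrix (Subtype.val : {e // e ∈ S} → m) id).absDet ^ 2 : ℝ) : ℂ) := by
  rw [Matrix.det_mul_eq_sum_functions,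
    ← Finset.sum_fiberwise (Finset.univ : Finset (n → m)) (fun f => Finset.univ.image f)]
  refine Finset.sum_congr rfl fun S _ => ?_
  -- a function whose image has the wrong cardinality is not injective
  have hzero : ∀ f : n → m, ¬ Function.Injective f → (N.submatrix f id).det = 0 := by
    intro f hf
    simp only [Function.Injective, not_forall] at hf
    obtain ⟨i, j, hij, hne⟩ := hf
    refine Matrix.det_zero_of_row_eq hne ?_
    funext k
    simp [hij]
  by_cases h : Nonempty (n ≃ {e // e ∈ S})
  · obtain ⟨e⟩ := h
    rw [Matrix.absDet_eq _ e]
    set M : Matrix n n ℂ := (N.submatrix (Subtype.val : {e // e ∈ S} → m) id).submatrix e id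
      with hM
    have h1 : (((‖M.det‖ ^ 2 : ℝ)) : ℂ) = (Mᴴ).det * M.det := by
      rw [Matrix.det_conjTranspose, Complex.ofReal_pow, ← Complex.conj_mul']
      rfl
    have h2 : (Mᴴ).det * M.det = ∑ σ : Equiv.Perm n,
        (∏ i, Mᴴ i (σ i)) * (M.submatrix σ id).det := by
      have h3 : (Mᴴ).det = ∑ σ : Equiv.Perm n,
          ((Equiv.Perm.sign σ : ℤ) : ℂ) * ∏ i, Mᴴ i (σ i) := by
        rw [← Matrix.det_transpose, Matrix.det_apply']
        rfl
      rw [h3, Finset.sum_mul]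
      refine Finset.sum_congr rfl fun σ _ => ?_
      rw [Matrix.det_permute]
      ring
    rw [h1, h2, Finset.mul_sum]
    symm
    refine Finset.sum_of_injOn (fun σ i => (e (σ i)).1) ?_ ?_ ?_ ?_
    · intro σ _ τ _ hστ
      ext i
      exact e.injective (Subtype.ext (congrFun hστ i))
    · intro σ _
      simp only [Finset.coe_filter, Finset.mem_univ, true_and, Set.mem_ofPred_eq]
      ext x
      simp only [Finset.mem_image, Finset.mem_univ, true_and]
      constructor
      · rintro ⟨i, rfl⟩
        exact (e (σ i)).2
      · intro hx
        exact ⟨σ.symm (e.symm ⟨x, hx⟩), by simp⟩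
    · intro f hf hfσ
      rw [hzero f, mul_zero]
      intro hinj
      apply hfσ
      simp only [Finset.mem_filter, Finset.mem_univ, true_and] at hf
      have hmem : ∀ i, f i ∈ S := fun i => hf ▸ Finset.mem_image_of_mem f (Finset.mem_univ i)
      let g : n → n := fun i => e.symm ⟨f i, hmem i⟩
      have hg : Function.Injective g := fun i j hij =>
        hinj (congrArg Subtype.val (e.symm.injective hij))
      refine ⟨Equiv.ofBijective g (Finite.injective_iff_bijective.1 hg), by simp, ?_⟩
      funext i
      simp [g]
    · intro σ _
      have h5 : ∏ x ∈ S, y x = ∏ i, y (e (σ i)).1 := by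
        rw [← Finset.prod_coe_sort S y]
        exact (Equiv.prod_comp (σ.trans e) (fun x : {e // e ∈ S} => y x.1)).symm
      have h6 : ∏ i, (Nᴴ * Matrix.diagonal y) i (e (σ i)).1 =
          (∏ i, y (e (σ i)).1) * ∏ i, Mᴴ i (σ i) := by
        rw [← Finset.prod_mul_distrib]
        refine Finset.prod_congr rfl fun i _ => ?_
        simp [Matrix.mul_diagonal, hM, mul_comm]
      rw [h5, h6, mul_assoc]
      rfl
  · rw [Matrix.absDet_of_isEmpty _ (not_nonempty_iff.1 h)]
    refine (Finset.sum_eq_zero fun f hf => ?_).trans (by simp)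
    rw [hzero f, mul_zero]
    intro hinj
    simp only [Finset.mem_filter, Finset.mem_univ, true_and] at hf
    have hmem : ∀ i, f i ∈ S := fun i => hf ▸ Finset.mem_image_of_mem f (Finset.mem_univ i)
    refine h ⟨Equiv.ofBijective (fun i => ⟨f i, hmem i⟩) ⟨fun i j hij =>
      hinj (congrArg Subtype.val hij), ?_⟩⟩
    rintro ⟨x, hx⟩
    rw [← hf] at hx
    obtain ⟨i, -, rfl⟩ := Finset.mem_image.1 hx
    exact ⟨i, rfl⟩

/-! ### Linear matroids -/

/-- The linear matroid of a finite family of vectors. -/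
theorem exists_matroid_linearIndepOn {α K V : Type*} [Finite α] [Field K] [AddCommGroup V]
    [Module K V] (a : α → V) :
    ∃ M : Matroid α, M.E = Set.univ ∧ ∀ F : Set α, M.Indep F ↔ LinearIndepOn K a F := by
  refine ⟨(IndepMatroid.ofFinite (Set.finite_univ) (fun F => LinearIndepOn K a F)
    (linearIndepOn_empty K a) (fun I J hJ hIJ => hJ.mono hIJ) ?_
    (fun I _ => Set.subset_univ I)).matroid, rfl, fun F => Iff.rfl⟩
  intro I J hI hJ hlt
  obtain ⟨b, hbJ, hIb, hspan, hb⟩ := exists_linearIndepOn_extension hI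
    (Set.subset_union_left (s := I) (t := J))
  by_cases hbI : b ⊆ I
  · exfalso
    have hbI' : b = I := hbI.antisymm hIb
    subst hbI'
    have h1 : a '' J ⊆ Submodule.span K (a '' b) :=
      (Set.image_mono Set.subset_union_right).trans hspan
    have : Module.Finite K (Submodule.span K (a '' b)) :=
      Module.Finite.span_of_finite K (Set.toFinite _)
    have h2 := Submodule.finrank_mono (Submodule.span_le.2 h1)
    have h3 : ∀ s : Set α, LinearIndepOn K a s →
        Module.finrank K (Submodule.span K (a '' s)) = s.ncard := by
      intro s hs
      have := Fintype.ofFinite s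
      have := finrank_span_eq_card (R := K) hs
      rw [Set.image_eq_range]
      rw [this, ← Nat.card_eq_fintype_card, Nat.card_coe_set_eq]
    rw [h3 _ hJ, h3 _ hI] at h2
    omega
  · obtain ⟨e, heb, heI⟩ := Set.not_subset.1 hbI
    refine ⟨e, ?_, heI, hb.mono (Set.insert_subset heb hIb)⟩
    rcases hbJ heb with h | h
    · exact absurd h heI
    · exact h

end LinearAlgebra

namespace SerreGraph

open Matrix

/-! ### Twisted coboundary matrices -/

noncomputable instance (X : SerreGraph.{u}) : Fintype X.H := Fintype.ofFinite _

/-- A chosen orientation of an edge. -/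
noncomputable def orient (X : SerreGraph.{u}) (e : X.E) : X.H := Quotient.out e

theorem edge_orient (X : SerreGraph.{u}) (e : X.E) : X.edge (X.orient e) = e :=
  Quotient.out_eq e

theorem edge_eq_edge_iff (X : SerreGraph.{u}) {h k : X.H} :
    X.edge h = X.edge k ↔ h = k ∨ h = X.inv k :=
  Quotient.eq (r := X.edgeSetoid)

theorem orient_edge (X : SerreGraph.{u}) (h : X.H) :
    X.orient (X.edge h) = h ∨ X.orient (X.edge h) = X.inv h :=
  X.edge_eq_edge_iff.1 (X.edge_orient (X.edge h))

theorem sum_halfEdges (X : SerreGraph.{u}) {A : Type*} [AddCommMonoid A] (f : X.H → A) :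
    ∑ h, f h = ∑ e : X.E, (f (X.orient e) + f (X.inv (X.orient e))) := by
  classical
  rw [← Finset.sum_fiberwise Finset.univ X.edge]
  refine Finset.sum_congr rfl fun e _ => ?_
  have h1 : Finset.univ.filter (fun h => X.edge h = e) = {X.orient e, X.inv (X.orient e)} := by
    ext h
    simp only [Finset.mem_filter, Finset.mem_univ, true_and, Finset.mem_insert,
      Finset.mem_singleton]
    conv_lhs => rw [← X.edge_orient e]
    exact X.edge_eq_edge_iff
  rw [h1, Finset.sum_pair (X.inv_ne _).symm]

section Coboundary

variable {X : SerreGraph.{u}} {K : Type*}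

/-- A gain function on oriented edges: reversing the orientation inverts the gain. -/
def IsGain [CommRing K] (ψ : X.H → K) : Prop := ∀ h, ψ h * ψ (X.inv h) = 1

theorem isGain_one [CommRing K] : IsGain (X := X) (1 : X.H → K) := fun _ => mul_one _

/-- A function on the vertices is flat outside `F` if parallel transport along every oriented edge
that is not in `F`, from its target to its source, is multiplication by the gain. -/
def IsFlat [CommRing K] (ψ : X.H → K) (F : Set X.E) (f : X.V → K) : Prop :=
  ∀ h, X.edge h ∉ F → f (X.root h) = ψ h * f (X.root (X.inv h))

open Classical in
/-- The coboundary matrix twisted by `ψ`.  Its rows are indexed by the edges, each with its chosen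
orientation. -/
noncomputable def coboundary [CommRing K] (ψ : X.H → K) : Matrix X.E X.V K :=
  Matrix.of fun e v => (if X.root (X.orient e) = v then 1 else 0) -
    ψ (X.orient e) * (if X.root (X.inv (X.orient e)) = v then 1 else 0)

/-- The rows of the coboundary matrix outside `F` and its columns in `W`. -/
noncomputable def coboundaryOn [CommRing K] (ψ : X.H → K) (F : Set X.E) (W : Set X.V) :
    Matrix {e // e ∉ F} {v // v ∈ W} K :=
  (coboundary ψ).submatrix Subtype.val Subtype.val

theorem coboundary_mulVec [CommRing K] (ψ : X.H → K) (f : X.V → K) (e : X.E) :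
    (coboundary ψ *ᵥ f) e =
      f (X.root (X.orient e)) - ψ (X.orient e) * f (X.root (X.inv (X.orient e))) := by
  classical
  simp [Matrix.mulVec, dotProduct, coboundary, sub_mul, Finset.sum_sub_distrib]

theorem isFlat_iff_coboundary_mulVec [CommRing K] {ψ : X.H → K} (hψ : IsGain ψ) (F : Set X.E)
    (f : X.V → K) : IsFlat ψ F f ↔ ∀ e ∉ F, (coboundary ψ *ᵥ f) e = 0 := by
  constructor
  · intro h e he
    rw [coboundary_mulVec, sub_eq_zero]
    exact h _ (by rwa [X.edge_orient])
  · intro h k hk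
    have h1 := h _ hk
    rw [coboundary_mulVec, sub_eq_zero] at h1
    rcases X.orient_edge k with h2 | h2
    · rwa [h2] at h1
    · rw [h2, X.inv_inv] at h1
      rw [h1, ← mul_assoc, hψ, one_mul]

theorem coboundaryOn_mulVec [CommRing K] (ψ : X.H → K) (F : Set X.E) (W : Set X.V)
    [Fintype {v // v ∈ W}] {f : X.V → K} (hf : ∀ v ∉ W, f v = 0) (e : {e // e ∉ F}) :
    (coboundaryOn ψ F W *ᵥ fun v => f v) e = (coboundary ψ *ᵥ f) e := by
  classical
  simp only [Matrix.mulVec, dotProduct, coboundaryOn, Matrix.submatrix_apply]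
  refine Fintype.sum_of_injective Subtype.val Subtype.val_injective _ _ (fun v hv => ?_)
    fun _ => rfl
  rw [hf v (by simpa using hv), mul_zero]

theorem IsFlat.eq_zero_iff [Field K] {ψ : X.H → K} (hψ : IsGain ψ) {F : Set X.E} {f : X.V → K}
    (hf : IsFlat ψ F f) {a b : X.V} (hab : X.Joined F a b) : f a = 0 ↔ f b = 0 := by
  induction hab with
  | refl => exact Iff.rfl
  | tail _ hbc ih =>
    obtain ⟨h, hF, rfl, rfl⟩ := hbc
    rw [ih, hf h hF, mul_eq_zero, or_iff_right (left_ne_zero_of_mul_eq_one (hψ h))]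

theorem IsFlat.norm_eq {ψ : X.H → ℂ} (hn : ∀ h, ‖ψ h‖ = 1) {F : Set X.E} {f : X.V → ℂ}
    (hf : IsFlat ψ F f) {a b : X.V} (hab : X.Joined F a b) : ‖f a‖ = ‖f b‖ := by
  induction hab with
  | refl => rfl
  | tail _ hbc ih =>
    obtain ⟨h, hF, rfl, rfl⟩ := hbc
    rw [ih, hf h hF, norm_mul, hn, one_mul]

/-- If every vertex can be joined outside `F` to a vertex that is not in `W`, then there is no
nonzero flat function supported in `W`, so the coboundary matrix is nonsingular. -/
theorem det_coboundaryOn_ne_zero [Field K] {ψ : X.H → K} (hψ : IsGain ψ) {F : Set X.E}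
    {W : Set X.V} [Fintype {v // v ∈ W}] [DecidableEq {v // v ∈ W}]
    (hF : ∀ v, ∃ d ∉ W, X.Joined F v d) (e : {v // v ∈ W} ≃ {e // e ∉ F}) :
    ((coboundaryOn ψ F W).submatrix e id).det ≠ 0 := by
  classical
  rw [Ne, ← Matrix.exists_mulVec_eq_zero_iff]
  rintro ⟨k, hk0, hk⟩
  apply hk0
  set f : X.V → K := fun v => if h : v ∈ W then k ⟨v, h⟩ else 0 with hf
  have hfW : ∀ v ∉ W, f v = 0 := fun v hv => by simp [hf, hv]
  have hkf : k = fun v : {v // v ∈ W} => f v := by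
    funext v
    simp [hf]
  have hflat : IsFlat ψ F f := by
    rw [isFlat_iff_coboundary_mulVec hψ]
    intro e' he'
    have h1 := coboundaryOn_mulVec ψ F W hfW ⟨e', he'⟩
    rw [← h1, ← hkf]
    have h2 := congrFun hk (e.symm ⟨e', he'⟩)
    simpa [Matrix.mulVec, dotProduct] using h2
  rw [hkf]
  funext v
  obtain ⟨d, hd, hvd⟩ := hF v
  exact (hflat.eq_zero_iff hψ hvd).2 (hfW d hd)

theorem coboundaryOn_one_map {K L : Type*} [CommRing K] [CommRing L] (φ : K →+* L)
    (F : Set X.E) (W : Set X.V) :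
    (coboundaryOn (1 : X.H → K) F W).map φ = coboundaryOn (1 : X.H → L) F W := by
  ext e v
  simp [coboundaryOn, coboundary, apply_ite φ]

/-- The untwisted coboundary matrix of a rooted spanning forest is unimodular: its determinant is
an integer that is not divisible by any prime number. -/
theorem norm_det_coboundaryOn_one {F : Set X.E} {W : Set X.V} [Fintype {v // v ∈ W}]
    [DecidableEq {v // v ∈ W}] (hF : ∀ v, ∃ d ∉ W, X.Joined F v d)
    (e : {v // v ∈ W} ≃ {e // e ∉ F}) :
    ‖((coboundaryOn (1 : X.H → ℂ) F W).submatrix e id).det‖ = 1 := by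
  set M : Matrix {v // v ∈ W} {v // v ∈ W} ℤ :=
    (coboundaryOn (1 : X.H → ℤ) F W).submatrix e id with hM
  have hmap : ∀ (L : Type) [CommRing L],
      ((coboundaryOn (1 : X.H → L) F W).submatrix e id).det = ((M.det : ℤ) : L) := by
    intro L _
    rw [← coboundaryOn_one_map (Int.castRingHom L) F W, ← eq_intCast (Int.castRingHom L),
      RingHom.map_det]
    rfl
  have h1 : M.det.natAbs = 1 := by
    rw [Nat.eq_one_iff_not_exists_prime_dvd]
    intro q hq hdvd
    have : Fact q.Prime := ⟨hq⟩
    refine det_coboundaryOn_ne_zero (K := ZMod q) isGain_one hF e ?_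
    rw [hmap, ZMod.intCast_zmod_eq_zero_iff_dvd]
    exact Int.natCast_dvd.2 hdvd
  rw [hmap ℂ]
  rcases Int.natAbs_eq M.det with h2 | h2 <;> rw [h2, h1] <;> simp

/-- The coboundary matrix of a rooted spanning forest, twisted by gains of absolute value one, has
determinant of absolute value one, and there is a gauge: a flat function of absolute value one.
The gauge is found by solving a linear system with this matrix, and it reduces the determinant to
the untwisted one. -/
theorem exists_gauge {ψ : X.H → ℂ} (hψ : IsGain ψ) (hn : ∀ h, ‖ψ h‖ = 1) {F : Set X.E}
    {W : Set X.V} (hF : ∀ v, ∃ d ∉ W, X.Joined F v d)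
    (hcard : Nonempty ({v // v ∈ W} ≃ {e // e ∉ F})) :
    (coboundaryOn ψ F W).absDet = 1 ∧
      ∃ g : X.V → ℂ, IsFlat ψ F g ∧ ∀ v, ‖g v‖ = 1 := by
  classical
  have := Fintype.ofFinite {v // v ∈ W}
  obtain ⟨e⟩ := hcard
  have hdet := det_coboundaryOn_ne_zero hψ hF e
  set A := (coboundaryOn ψ F W).submatrix e id with hA
  set c : X.V → ℂ := fun v => if v ∈ W then 0 else 1 with hc
  set k : {v // v ∈ W} → ℂ := A⁻¹ *ᵥ fun i => -(coboundary ψ *ᵥ c) (e i) with hk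
  have hAk : A *ᵥ k = fun i => -(coboundary ψ *ᵥ c) (e i) := by
    rw [hk, Matrix.mulVec_mulVec, Matrix.mul_nonsing_inv _ (isUnit_iff_ne_zero.2 hdet),
      Matrix.one_mulVec]
  set f : X.V → ℂ := fun v => if h : v ∈ W then k ⟨v, h⟩ else 0 with hf
  have hfW : ∀ v ∉ W, f v = 0 := fun v hv => by simp [hf, hv]
  have hkf : k = fun v : {v // v ∈ W} => f v := by
    funext v
    simp [hf]
  have hflat : IsFlat ψ F (c + f) := by
    rw [isFlat_iff_coboundary_mulVec hψ]
    intro e' he'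
    have h1 := coboundaryOn_mulVec ψ F W hfW ⟨e', he'⟩
    have h2 := congrFun hAk (e.symm ⟨e', he'⟩)
    rw [← hkf] at h1
    have h3 : (A *ᵥ k) (e.symm ⟨e', he'⟩) = (coboundaryOn ψ F W *ᵥ k) ⟨e', he'⟩ := by
      simp [Matrix.mulVec, dotProduct, hA]
    rw [h3, h1, Equiv.apply_symm_apply] at h2
    rw [Matrix.mulVec_add, Pi.add_apply, h2, add_neg_cancel]
  have hnorm : ∀ v, ‖(c + f) v‖ = 1 := by
    intro v
    obtain ⟨d, hd, hvd⟩ := hF v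
    rw [hflat.norm_eq hn hvd, Pi.add_apply, hfW d hd, hc]
    simp [hd]
  refine ⟨?_, c + f, hflat, hnorm⟩
  rw [Matrix.absDet_eq _ e, ← norm_det_coboundaryOn_one hF e]
  set g := c + f with hg
  have h4 : A * Matrix.diagonal (fun v => g v.1) =
      Matrix.diagonal (fun i => g (X.root (X.orient (e i).1))) *
        (coboundaryOn (1 : X.H → ℂ) F W).submatrix e id := by
    ext i v
    have h5 := hflat (X.orient (e i).1) (by rw [X.edge_orient]; exact (e i).2)
    simp only [Matrix.mul_diagonal, Matrix.diagonal_mul, hA, Matrix.submatrix_apply, id,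
      coboundaryOn, coboundary, Matrix.of_apply, Pi.one_apply, one_mul]
    by_cases ha : X.root (X.orient (e i).1) = v.1 <;>
      by_cases hb : X.root (X.inv (X.orient (e i).1)) = v.1 <;>
      simp only [ha, hb, if_true, if_false] at h5 ⊢ <;>
      first | ring1 | linear_combination h5
  have h6 := congrArg (fun M => ‖Matrix.det M‖) h4
  simpa [Matrix.det_mul, Matrix.det_diagonal, norm_mul, norm_prod, hnorm] using h6

end Coboundary
end SerreGraph

namespace SerreGraph

open Matrix

/-! ### Laplacians and the matrix-tree theorem -/

section Laplacian

variable {X : SerreGraph.{u}}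

open Classical in
/-- The Laplacian matrix with edge conductances `y`, twisted by `ψ`. -/
noncomputable def laplacian (ψ : X.H → ℂ) (y : X.E → ℂ) : Matrix X.V X.V ℂ :=
  (coboundary ψ)ᴴ * Matrix.diagonal y * coboundary ψ

open Classical in
/-- The entries of the Laplacian as sums over all oriented edges; the chosen orientations have
disappeared. -/
theorem laplacian_apply {ψ : X.H → ℂ} (hψ : ∀ h, ψ (X.inv h) = star (ψ h))
    (hn : ∀ h, ‖ψ h‖ = 1) (y : X.E → ℂ) (a b : X.V) :
    laplacian ψ y a b = ∑ h : X.H, y (X.edge h) * (if X.root h = a then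
      ((if a = b then 1 else 0) - (if X.root (X.inv h) = b then ψ h else 0)) else 0) := by
  rw [X.sum_halfEdges]
  rw [laplacian, Matrix.mul_apply]
  simp only [Matrix.mul_diagonal, Matrix.conjTranspose_apply]
  refine Finset.sum_congr rfl fun e _ => ?_
  have h1 : ψ (X.orient e) * star (ψ (X.orient e)) = 1 := by
    have := Complex.mul_conj' (ψ (X.orient e))
    rw [hn] at this
    simpa using this
  simp only [X.edge_inv, X.edge_orient, X.inv_inv, coboundary, Matrix.of_apply, hψ]
  generalize ψ (X.orient e) = z at *
  generalize X.root (X.orient e) = p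
  generalize X.root (X.inv (X.orient e)) = q
  have hif : ∀ (P : Prop) [Decidable P], star (if P then (1 : ℂ) else 0) = if P then 1 else 0 := by
    intro P _
    split_ifs <;> simp
  simp only [star_sub, star_mul', hif]
  by_cases hpa : p = a <;> by_cases hqa : q = a <;> by_cases hpb : p = b <;> by_cases hqb : q = b <;>
    by_cases hab : a = b <;> simp_all <;>
    first | ring1 | linear_combination (y e) * h1

end Laplacian

section Trees

variable (X : SerreGraph.{u})

theorem connected_spanning_iff [Nonempty X.V] (T : Set X.E) :
    (X.spanning T).toGraph.Connected ↔ ∀ a b, X.Joined Tᶜ a b := by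
  constructor
  · rintro ⟨-, h⟩ a b
    refine Relation.ReflTransGen.lift Subtype.val ?_ _ _ (h ⟨a, Set.mem_univ a⟩ ⟨b, Set.mem_univ b⟩)
    rintro x y ⟨h, -, h1, h2⟩
    exact ⟨h.1, not_not.2 h.2, congrArg Subtype.val h1, congrArg Subtype.val h2⟩
  · intro h
    refine ⟨⟨⟨Classical.arbitrary X.V, Set.mem_univ _⟩⟩, fun a b => ?_⟩
    refine Relation.ReflTransGen.lift (fun v => (⟨v, Set.mem_univ v⟩ :
      (X.spanning T).toGraph.V)) ?_ _ _ (h a.1 b.1)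
    rintro x y ⟨h, h0, h1, h2⟩
    exact ⟨⟨h, not_not.1 h0⟩, Set.notMem_empty _, Subtype.ext h1, Subtype.ext h2⟩

theorem card_spanning_edges (T : Set X.E) : Nat.card (X.spanning T).toGraph.E = T.ncard := by
  rw [← Nat.card_coe_set_eq]
  let f : (X.spanning T).toGraph.E → T := fun e => Quotient.liftOn e
    (fun h : (X.spanning T).toGraph.H => (⟨X.edge h.1, h.2⟩ : T)) (by
      rintro a b (rfl | rfl)
      · rfl
      · exact Subtype.ext (X.edge_inv b.1))
  refine Nat.card_congr (Equiv.ofBijective f ⟨?_, ?_⟩)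
  · intro a b
    induction a using Quotient.inductionOn with | _ a
    induction b using Quotient.inductionOn with | _ b
    intro hab
    refine Quotient.sound ?_
    rcases X.edge_eq_edge_iff.1 (congrArg Subtype.val hab) with h | h
    · exact Or.inl (Subtype.ext h)
    · exact Or.inr (Subtype.ext h)
  · rintro ⟨e, he⟩
    refine ⟨(X.spanning T).toGraph.edge ⟨X.orient e, ?_⟩, ?_⟩
    · show X.edge (X.orient e) ∈ T
      rwa [X.edge_orient]
    · exact Subtype.ext (X.edge_orient e)

theorem isTree_spanning_iff [Nonempty X.V] (T : Finset X.E) :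
    (X.spanning (T : Set X.E)).toGraph.IsTree ↔
      (∀ a b, X.Joined (T : Set X.E)ᶜ a b) ∧ T.card + 1 = Fintype.card X.V := by
  rw [IsTree, X.connected_spanning_iff, genus, X.card_spanning_edges]
  have h1 : Nat.card (X.spanning (T : Set X.E)).toGraph.V = Fintype.card X.V := by
    rw [← Nat.card_eq_fintype_card]
    exact Nat.card_congr (Equiv.Set.univ X.V)
  rw [h1, Set.ncard_coe_finset]
  refine and_congr_right fun _ => ?_
  omega

/-- The coboundary matrix with one more row, the values `m` of a mass function.  The index of this
row is `none`. -/
noncomputable def massCoboundary (m : X.V → ℂ) : Matrix (Option X.E) X.V ℂ :=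
  Matrix.of fun o v => o.elim (m v) fun e => coboundary (1 : X.H → ℂ) e v

variable {X}

/-- A rank one perturbation of the Laplacian, as a product. -/
theorem massCoboundary_product [DecidableEq X.E] (m : X.V → ℝ) (s : ℂ) (y : X.E → ℂ) :
    (X.massCoboundary fun v => (m v : ℂ))ᴴ * Matrix.diagonal (fun o : Option X.E => o.elim s y) *
      (X.massCoboundary fun v => (m v : ℂ)) =
    laplacian (1 : X.H → ℂ) y + Matrix.of fun a b => s * m a * m b := by
  ext a b
  rw [Matrix.add_apply, laplacian, Matrix.mul_apply, Matrix.mul_apply, Fintype.sum_option,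
    add_comm]
  simp only [Matrix.mul_diagonal, Matrix.conjTranspose_apply, massCoboundary, Matrix.of_apply,
    Option.elim]
  congr 1
  simp
  exact Or.inl (mul_comm _ _)

open Classical in
/-- A maximal minor of the coboundary matrix with the mass row detects spanning trees: for a
spanning tree, adding all columns to one of them leaves the total mass times a unimodular minor;
for a disconnected subgraph, some locally constant function has total mass zero. -/
theorem absDet_massCoboundary [Nonempty X.V] {m : X.V → ℝ} (hm : ∀ v, 0 < m v)
    (T : Finset X.E) :
    ((X.massCoboundary fun v => (m v : ℂ)).submatrix
      (Subtype.val : {o // o ∈ Finset.insertNone T} → Option X.E) id).absDet =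
    if (X.spanning (T : Set X.E)).toGraph.IsTree then ∑ v, m v else 0 := by
  have hpos : 0 < ∑ v, m v := Finset.sum_pos (fun v _ => hm v) Finset.univ_nonempty
  have hker : ∀ f : X.V → ℂ, IsFlat (1 : X.H → ℂ) (T : Set X.E)ᶜ f → ∑ v, (m v : ℂ) * f v = 0 →
      (X.massCoboundary fun v => (m v : ℂ)).submatrix
        (Subtype.val : {o // o ∈ Finset.insertNone T} → Option X.E) id *ᵥ f = 0 := by
    rintro f hf hmf
    funext ⟨o, ho⟩
    rcases o with _ | e
    · exact hmf
    · rw [isFlat_iff_coboundary_mulVec isGain_one] at hf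
      exact hf e (by simpa using ho)
  split_ifs with h
  · rw [isTree_spanning_iff] at h
    obtain ⟨hconn, hcard⟩ := h
    obtain ⟨r⟩ := ‹Nonempty X.V›
    have hF : ∀ v, ∃ d ∉ ({r}ᶜ : Set X.V), X.Joined (T : Set X.E)ᶜ v d :=
      fun v => ⟨r, by simp, hconn v r⟩
    have e1 : {e // e ∉ (T : Set X.E)ᶜ} ≃ {e // e ∈ T} := Equiv.subtypeEquivRight (by simp)
    have hne : Nonempty ({v // v ∈ ({r}ᶜ : Set X.V)} ≃ {e // e ∉ (T : Set X.E)ᶜ}) := by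
      refine ⟨Fintype.equivOfCardEq ?_⟩
      rw [Fintype.card_congr e1]
      have h2 : Fintype.card {v // v ∈ ({r}ᶜ : Set X.V)} = Fintype.card X.V - 1 := by
        rw [← Set.card_ne_eq r]
        rfl
      rw [h2]
      simp
      omega
    have hU := (exists_gauge (X := X) isGain_one (by simp) hF hne).1
    let eR : {e // e ∉ (T : Set X.E)ᶜ} ⊕ Unit ≃ {o // o ∈ Finset.insertNone T} :=
      { toFun := Sum.elim (fun e => ⟨some e.1, by simpa using e.2⟩) (fun _ => ⟨none, by simp⟩)
        invFun := fun o => match o with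
          | ⟨none, _⟩ => Sum.inr ()
          | ⟨some e, he⟩ => Sum.inl ⟨e, by simpa using he⟩
        left_inv := by rintro (e | e) <;> rfl
        right_inv := by rintro ⟨_ | e, he⟩ <;> rfl }
    let eC : {v // v ∈ ({r}ᶜ : Set X.V)} ⊕ Unit ≃ X.V :=
      { toFun := Sum.elim Subtype.val (fun _ => r)
        invFun := fun v => if hv : v = r then Sum.inr () else Sum.inl ⟨v, hv⟩
        left_inv := by
          rintro (⟨v, hv⟩ | v)
          · have hv' : v ≠ r := hv
            simp [hv']
          · simp
        right_inv := by
          intro v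
          by_cases hv : v = r <;> simp [hv] }
    rw [← Matrix.absDet_submatrix _ eR eC]
    have hblock : (((X.massCoboundary fun v => (m v : ℂ)).submatrix
        (Subtype.val : {o // o ∈ Finset.insertNone T} → Option X.E) id).submatrix eR eC) =
        Matrix.fromBlocks (coboundaryOn (1 : X.H → ℂ) (T : Set X.E)ᶜ {r}ᶜ)
          (Matrix.of fun e _ => coboundary (1 : X.H → ℂ) e.1 r)
          (Matrix.of fun _ v => (m v.1 : ℂ)) (Matrix.of fun _ _ => (m r : ℂ)) := by
      ext (i | i) (j | j) <;> rfl
    have hsum : ∀ F : X.V → ℂ, ∑ v : {v // v ∈ ({r}ᶜ : Set X.V)}, F v.1 + F r = ∑ v, F v := by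
      intro F
      rw [← Equiv.sum_comp eC, Fintype.sum_sum_type]
      simp [eC]
    rw [hblock, Matrix.absDet_fromBlocks _ _ _ _ hne (Matrix.of fun _ _ => 1), hU, one_mul,
      Matrix.det_unique]
    · simp only [Matrix.add_apply, Matrix.mul_apply, Matrix.of_apply, mul_one]
      rw [hsum fun v => (m v : ℂ), ← Complex.ofReal_sum, Complex.norm_real, Real.norm_eq_abs,
        abs_of_pos hpos]
    · ext i j
      simp only [Matrix.add_apply, Matrix.mul_apply, Matrix.of_apply, mul_one, coboundaryOn,
        Matrix.submatrix_apply, Matrix.zero_apply]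
      rw [hsum fun v => coboundary (1 : X.H → ℂ) i.1 v]
      have := coboundary_mulVec (1 : X.H → ℂ) (fun _ => 1) i.1
      simpa [Matrix.mulVec, dotProduct] using this
  · by_contra h0
    obtain ⟨⟨e⟩, hinj⟩ := (Matrix.absDet_ne_zero_iff _).1 h0
    apply h
    rw [isTree_spanning_iff]
    constructor
    · intro a b
      by_contra hab
      -- the indicator function of a component, corrected by a constant to have total mass zero
      set c : X.V → ℂ := fun v => if X.Joined (T : Set X.E)ᶜ a v then 1 else 0 with hc
      set f : X.V → ℂ := fun v => (∑ v, (m v : ℂ)) * c v - ∑ v, (m v : ℂ) * c v with hf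
      have hcf : IsFlat (1 : X.H → ℂ) (T : Set X.E)ᶜ c := by
        intro h hh
        have h1 : X.Joined (T : Set X.E)ᶜ a (X.root h) ↔
            X.Joined (T : Set X.E)ᶜ a (X.root (X.inv h)) :=
          ⟨fun h2 => h2.tail ⟨h, hh, rfl, rfl⟩, fun h2 => h2.tail ⟨X.inv h, by rwa [X.edge_inv],
            rfl, by rw [X.inv_inv]⟩⟩
        simp [hc, h1]
      have hff : IsFlat (1 : X.H → ℂ) (T : Set X.E)ᶜ f := by
        intro h hh
        have := hcf h hh
        simp only [Pi.one_apply, one_mul] at this ⊢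
        simp only [hf, this]
      have hf0 := hinj f (hker f hff (by
        have h1 : ∀ v, (m v : ℂ) * f v =
            (∑ v, (m v : ℂ)) * ((m v : ℂ) * c v) - (m v : ℂ) * ∑ v, (m v : ℂ) * c v := by
          intro v
          simp only [hf]
          ring
        simp_rw [h1]
        rw [Finset.sum_sub_distrib, ← Finset.mul_sum, ← Finset.sum_mul, sub_self]))
      have ha := congrFun hf0 a
      have hb := congrFun hf0 b
      have hca : c a = 1 := if_pos Relation.ReflTransGen.refl
      have hcb : c b = 0 := if_neg hab
      simp only [hf, hca, hcb, Pi.zero_apply] at ha hb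
      have h3 : (∑ v, (m v : ℂ)) = 0 := by linear_combination ha - hb
      rw [← Complex.ofReal_sum, Complex.ofReal_eq_zero] at h3
      exact hpos.ne' h3
    · have := Fintype.card_congr e
      rw [this, Fintype.card_coe, Finset.card_insertNone]

/-- The matrix-tree theorem, for a rank one perturbation of the Laplacian.  The conductances of the
edges of a tree are multiplied here; passing to the edges outside of the tree inverts them. -/
theorem det_laplacian_add [Nonempty X.V] [DecidableEq X.V] {m : X.V → ℝ} (hm : ∀ v, 0 < m v)
    (s : ℂ) (y : X.E → ℂ) [DecidablePred fun T : Finset X.E =>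
      (X.spanning (T : Set X.E)).toGraph.IsTree] :
    (laplacian (1 : X.H → ℂ) y + Matrix.of fun a b => s * m a * m b).det =
      s * ((∑ v, m v : ℝ) : ℂ) ^ 2 * ∑ T ∈ Finset.filter (fun T : Finset X.E =>
        (X.spanning (T : Set X.E)).toGraph.IsTree) Finset.univ, ∏ e ∈ T, y e := by
  classical
  rw [← massCoboundary_product, Matrix.det_conjTranspose_mul_diagonal_mul, Finset.mul_sum,
    Finset.sum_filter]
  symm
  refine Finset.sum_of_injOn Finset.insertNone (Finset.insertNone.injective.injOn)
    (fun _ _ => Finset.mem_coe.2 (Finset.mem_univ _)) ?_ ?_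
  · intro S _ hS
    have hnone : none ∉ S := by
      intro h
      apply hS
      refine ⟨Finset.eraseNone S, by simp, ?_⟩
      rw [Finset.insertNone_eraseNone, Finset.insert_eq_of_mem h]
    -- constant functions are in the kernel of every minor without the mass row
    have h0 : ((X.massCoboundary fun v => (m v : ℂ)).submatrix
        (Subtype.val : {o // o ∈ S} → Option X.E) id).absDet = 0 := by
      by_contra h0
      have h1 := ((Matrix.absDet_ne_zero_iff _).1 h0).2 1 (by
        funext ⟨o, ho⟩
        rcases o with _ | e
        · exact absurd ho hnone
        · have : (coboundary (1 : X.H → ℂ) *ᵥ 1) e = 0 := by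
            rw [coboundary_mulVec]
            simp
          exact this)
      exact one_ne_zero h1
    rw [h0]
    simp
  · intro T _
    rw [absDet_massCoboundary hm]
    have h2 : ∏ o ∈ Finset.insertNone T, (o.elim s y : ℂ) = s * ∏ e ∈ T, y e := by
      rw [Finset.prod_insertNone]
      rfl
    rw [h2]
    split_ifs
    · push_cast
      ring
    · simp

end Trees
end SerreGraph

namespace SerreGraph

open Matrix

/-! ### Components and simple cycles -/

section Cycles

variable {X : SerreGraph.{u}}

theorem component_eq_iff {F : Set X.E} {a b : X.V} :
    X.component F a = X.component F b ↔ X.Joined F a b :=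
  Quotient.eq (r := X.joinedSetoid F)

theorem Joined.symm {F : Set X.E} {a b : X.V} (h : X.Joined F a b) : X.Joined F b a :=
  (X.joinedSetoid F).symm h

theorem component_root_inv {F : Set X.E} {h : X.H} (hF : X.edge h ∉ F) :
    X.component F (X.root (X.inv h)) = X.component F (X.root h) :=
  (component_eq_iff.2 (Relation.ReflTransGen.single ⟨h, hF, rfl, rfl⟩)).symm

/-- A simple cycle in a subgraph, as a cyclic sequence of oriented edges. -/
structure IsSimpleCycle (Y : X.Subgraph) (n : ℕ) (c : Fin (n + 1) → X.H) : Prop where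
  mem : ∀ i, c i ∈ Y.halfs
  step : ∀ i, X.root (X.inv (c i)) = X.root (c (i + 1))
  root_injective : Function.Injective fun i => X.root (c i)
  edge_injective : Function.Injective fun i => X.edge (c i)

/-- If every oriented edge of a nonempty set can be followed by another one without backtracking,
the set contains a simple cycle: the first return to a vertex closes one. -/
theorem exists_simpleCycle {Y : X.Subgraph} {A : Set X.H} (hAY : A ⊆ Y.halfs)
    (hne : A.Nonempty)
    (hA : ∀ h ∈ A, ∃ k ∈ A, X.root k = X.root (X.inv h) ∧ k ≠ X.inv h) :
    ∃ n c, IsSimpleCycle (X := X) Y n c := by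
  classical
  obtain ⟨a, ha⟩ := hne
  choose! next hmem hroot hback using hA
  set s : ℕ → X.H := fun n => next^[n] a with hs
  have hsucc : ∀ n, s (n + 1) = next (s n) := fun n => Function.iterate_succ_apply' next n a
  have hsA : ∀ n, s n ∈ A := by
    intro n
    induction n with
    | zero => exact ha
    | succ n ih => rw [hsucc]; exact hmem _ ih
  have hstep : ∀ n, X.root (X.inv (s n)) = X.root (s (n + 1)) := by
    intro n
    rw [hsucc, hroot _ (hsA n)]
  have hex : ∃ j, ∃ i < j, X.root (s i) = X.root (s j) := by
    obtain ⟨i, j, hij, h⟩ := Finite.exists_ne_map_eq_of_infinite fun n => X.root (s n)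
    rcases lt_or_gt_of_ne hij with h1 | h1
    · exact ⟨j, i, h1, h⟩
    · exact ⟨i, j, h1, h.symm⟩
  obtain ⟨i, hij, hroots⟩ := Nat.find_spec hex
  set j := Nat.find hex with hj
  have hinj : ∀ p q, p < q → q < j → X.root (s p) ≠ X.root (s q) :=
    fun p q hpq hq h => Nat.find_min hex hq ⟨p, hpq, h⟩
  obtain ⟨n, hn⟩ : ∃ n, j = i + (n + 1) := ⟨j - i - 1, by omega⟩
  have hedge : ∀ p q, p < q → q < j → X.edge (s p) ≠ X.edge (s q) := by
    intro p q hpq hq h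
    rcases X.edge_eq_edge_iff.1 h with h1 | h1
    · exact hinj p q hpq hq (congrArg X.root h1)
    · have h2 : X.inv (s p) = s q := by rw [h1, X.inv_inv]
      have h3 : X.root (s (p + 1)) = X.root (s q) := by rw [← hstep, h2]
      have h4 : p + 1 = q := by
        by_contra h4
        exact hinj (p + 1) q (by omega) hq h3
      apply hback _ (hsA p)
      rw [h2, ← hsucc, h4]
  refine ⟨n, fun k => s (i + k), fun k => hAY (hsA _), fun k => ?_, ?_, ?_⟩
  · rw [hstep]
    by_cases hk : k = Fin.last n
    · subst hk
      simp only [Fin.last_add_one, Fin.val_last, Fin.val_zero, add_zero]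
      rw [add_assoc, ← hn, hroots]
    · rw [Fin.val_add_one_of_lt (Fin.lt_last_iff_ne_last.2 hk)]
      rfl
  · intro k l hkl
    by_contra hne
    rcases lt_or_gt_of_ne hne with h1 | h1
    · exact hinj (i + k) (i + l) (by have := Fin.lt_def.1 h1; omega) (by have := l.2; omega) hkl
    · exact hinj (i + l) (i + k) (by have := Fin.lt_def.1 h1; omega) (by have := k.2; omega)
        hkl.symm
  · intro k l hkl
    by_contra hne
    rcases lt_or_gt_of_ne hne with h1 | h1
    · exact hedge (i + k) (i + l) (by have := Fin.lt_def.1 h1; omega) (by have := l.2; omega) hkl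
    · exact hedge (i + l) (i + k) (by have := Fin.lt_def.1 h1; omega) (by have := k.2; omega)
        hkl.symm

open Classical in
/-- The support of a nonzero circulation contains a simple cycle: at no vertex can exactly one
oriented edge start in the support. -/
theorem exists_simpleCycle_of_circulation {Y : X.Subgraph} {c : X.E → ℂ} (hc0 : c ≠ 0)
    (hY : ∀ h, c (X.edge h) ≠ 0 → h ∈ Y.halfs)
    (hc : ∀ v, ∑ e, c e * coboundary (1 : X.H → ℂ) e v = 0) :
    ∃ n c, IsSimpleCycle (X := X) Y n c := by
  refine exists_simpleCycle (A := {h | c (X.edge h) ≠ 0}) hY ?_ ?_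
  · obtain ⟨e, he⟩ := Function.ne_iff.1 hc0
    exact ⟨X.orient e, by simpa [X.edge_orient] using he⟩
  · intro h hh
    by_contra! hcon
    set v := X.root (X.inv h) with hv
    have h1 : ∑ k : X.H, (if X.root k = v then
        (if k = X.orient (X.edge k) then c (X.edge k) else - c (X.edge k)) else 0) = 0 := by
      refine (X.sum_halfEdges _).trans ((Finset.sum_congr rfl fun e _ => ?_).trans (hc v))
      rw [X.edge_inv, X.edge_orient]
      simp only [X.inv_ne, if_true, if_false, coboundary, Matrix.of_apply, Pi.one_apply, one_mul]
      split_ifs <;> ring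
    rw [Finset.sum_eq_single (X.inv h)] at h1
    · rw [if_pos hv.symm, X.edge_inv] at h1
      have h2 : c (X.edge h) ≠ 0 := hh
      split_ifs at h1
      · exact h2 h1
      · exact h2 (neg_eq_zero.1 h1)
    · intro k _ hk
      split_ifs with h2 h3
      · by_contra h4
        exact hk (hcon k h4 h2)
      · by_contra h4
        exact hk (hcon k (neg_ne_zero.1 h4) h2)
      · rfl
    · simp

open Classical in
/-- A component without nonzero flat functions contains a simple cycle.  It has at least as many
edges as vertices, and hence carries a nonzero circulation. -/
theorem exists_simpleCycle_component {ψ : X.H → ℂ} (hψ : IsGain ψ) {F : Set X.E} (C : X.Component F)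
    (hC : ∀ f : X.V → ℂ, (∀ v, X.component F v ≠ C → f v = 0) → IsFlat ψ F f → f = 0) :
    ∃ n c, IsSimpleCycle (X := X) C.subgraph n c := by
  let VC := {v // X.component F v = C}
  let EC := {e // e ∉ F ∧ X.component F (X.root (X.orient e)) = C}
  have hEC : ∀ h, (X.edge h ∉ F ∧ X.component F (X.root (X.orient (X.edge h))) = C) ↔
      (X.edge h ∉ F ∧ X.component F (X.root h) = C) := by
    intro h
    refine and_congr_right fun hF => ?_
    rcases X.orient_edge h with h1 | h1
    · rw [h1]
    · rw [h1, component_root_inv hF]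
  obtain ⟨r, hr⟩ : ∃ r, X.component F r = C := Quotient.exists_rep C
  -- the twisted coboundary map of the component is injective
  have hcard : Fintype.card VC ≤ Fintype.card EC := by
    let L : (VC → ℂ) →ₗ[ℂ] (EC → ℂ) :=
      { toFun := fun f e =>
          (if h : X.component F (X.root (X.orient e.1)) = C then f ⟨_, h⟩ else 0) -
            ψ (X.orient e.1) *
              (if h : X.component F (X.root (X.inv (X.orient e.1))) = C then f ⟨_, h⟩ else 0)
        map_add' := by
          intro f g
          funext e
          simp only [Pi.add_apply]
          split_ifs <;> ring
        map_smul' := by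
          intro a f
          funext e
          simp only [Pi.smul_apply, smul_eq_mul, RingHom.id_apply]
          split_ifs <;> ring }
    have hL : Function.Injective L := by
      rw [← LinearMap.ker_eq_bot, LinearMap.ker_eq_bot']
      intro f hf
      set f' : X.V → ℂ := fun v => if h : X.component F v = C then f ⟨v, h⟩ else 0 with hf'
      have hf0 : f' = 0 := by
        refine hC f' (fun v hv => dif_neg hv) ?_
        rw [isFlat_iff_coboundary_mulVec hψ]
        intro e he
        rw [coboundary_mulVec]
        by_cases heC : X.component F (X.root (X.orient e)) = C
        · exact congrFun hf ⟨e, he, heC⟩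
        · have heC' : X.component F (X.root (X.inv (X.orient e))) ≠ C := by
            rwa [component_root_inv (by rwa [X.edge_orient])]
          simp [hf', heC, heC']
      funext v
      have := congrFun hf0 v.1
      exact (by simpa only [hf', dif_pos v.2] using this : f v = (0 : X.V → ℂ) v.1)
    have := LinearMap.finrank_le_finrank_of_injective hL
    rwa [Module.finrank_fintype_fun_eq_card, Module.finrank_fintype_fun_eq_card] at this
  -- conservation is imposed at all vertices but `r`; it follows at `r`, as the rows sum to zero
  let VC' := {v // X.component F v = C ∧ v ≠ r}
  have hcard' : Fintype.card VC' < Fintype.card VC := by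
    refine Fintype.card_lt_of_injective_of_notMem
      (fun v : VC' => (⟨v.1, v.2.1⟩ : VC)) ?_ (b := ⟨r, hr⟩) ?_
    · intro a b hab
      exact Subtype.ext (congrArg (fun x : VC => x.1) hab)
    · rintro ⟨v, hv⟩
      exact v.2.2 (congrArg Subtype.val hv)
  let M : (EC → ℂ) →ₗ[ℂ] (VC' → ℂ) :=
    { toFun := fun c v => ∑ e : EC, c e * coboundary (1 : X.H → ℂ) e.1 v.1
      map_add' := by
        intro f g
        funext e
        simp [add_mul, Finset.sum_add_distrib]
      map_smul' := by
        intro a f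
        funext e
        simp [Finset.mul_sum, mul_assoc] }
  have hM : LinearMap.ker M ≠ ⊥ := by
    refine LinearMap.ker_ne_bot_of_finrank_lt ?_
    rw [Module.finrank_fintype_fun_eq_card, Module.finrank_fintype_fun_eq_card]
    exact hcard'.trans_le hcard
  obtain ⟨c, hc, hc0⟩ := Submodule.exists_mem_ne_zero_of_ne_bot hM
  set c' : X.E → ℂ := fun e => if h : e ∉ F ∧ X.component F (X.root (X.orient e)) = C then
    c ⟨e, h⟩ else 0 with hc'
  have hsum : ∀ φ : X.E → ℂ, ∑ e, c' e * φ e = ∑ e : EC, c e * φ e.1 := by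
    intro φ
    symm
    refine Fintype.sum_of_injective Subtype.val Subtype.val_injective _ _ (fun v hv => ?_)
      fun e => ?_
    · simp only [hc']
      rw [dif_neg, zero_mul]
      intro h
      exact hv ⟨⟨v, h⟩, rfl⟩
    · simp only [hc']
      rw [dif_pos e.2]
  have hrow : ∀ e, ∑ v, coboundary (1 : X.H → ℂ) e v = 0 := by
    intro e
    have := coboundary_mulVec (1 : X.H → ℂ) (fun _ => 1) e
    simpa [Matrix.mulVec, dotProduct] using this
  have hother : ∀ v, v ≠ r → ∑ e, c' e * coboundary (1 : X.H → ℂ) e v = 0 := by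
    intro v hv
    rw [hsum]
    by_cases hvC : X.component F v = C
    · exact congrFun hc ⟨v, hvC, hv⟩
    · refine Finset.sum_eq_zero fun e _ => ?_
      have h1 : X.root (X.orient e.1) ≠ v := fun h => hvC (h ▸ e.2.2)
      have h2 : X.root (X.inv (X.orient e.1)) ≠ v := by
        intro h
        apply hvC
        rw [← h, component_root_inv (by rw [X.edge_orient]; exact e.2.1), e.2.2]
      simp [coboundary, h1, h2]
  refine exists_simpleCycle_of_circulation (c := c') ?_ ?_ ?_
  · intro h0
    apply hc0
    funext e
    have := congrFun h0 e.1
    exact (by simpa only [hc', dif_pos e.2] using this : c e = (0 : X.E → ℂ) e.1)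
  · intro h hh
    refine (hEC h).1 ?_
    by_contra hcon
    exact hh (dif_neg hcon)
  · intro v
    by_cases hv : v = r
    · subst hv
      have h1 : ∑ v, ∑ e, c' e * coboundary (1 : X.H → ℂ) e v = 0 := by
        rw [Finset.sum_comm]
        refine Finset.sum_eq_zero fun e _ => ?_
        rw [← Finset.mul_sum, hrow, mul_zero]
      rwa [Finset.sum_eq_single v (fun w _ hw => hother w hw) (by simp)] at h1
    · exact hother v hv

open Fin.NatCast in
/-- Going around a simple cycle, starting after its first edge. -/
theorem IsSimpleCycle.transport {Y : X.Subgraph} {n : ℕ} {c : Fin (n + 1) → X.H}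
    (hc : IsSimpleCycle Y n c) {ψ : X.H → ℂ} {f : X.V → ℂ}
    (hf : ∀ i ≠ 0, f (X.root (c i)) = ψ (c i) * f (X.root (X.inv (c i)))) :
    ψ (c 0) * f (X.root (X.inv (c 0))) = (∏ i, ψ (c i)) * f (X.root (c 0)) := by
  have key : ∀ k ≤ n, f (X.root (X.inv (c 0))) =
      (∏ i ∈ Finset.range k, ψ (c ((i + 1 : ℕ) : Fin (n + 1)))) *
        f (X.root (X.inv (c (k : Fin (n + 1))))) := by
    intro k
    induction k with
    | zero => simp
    | succ k ih =>
      intro hk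
      rw [ih (by omega), hc.step, Finset.prod_range_succ, mul_assoc, ← hf]
      · simp
      · intro h
        have := congrArg Fin.val h
        rw [Fin.val_natCast, Nat.mod_eq_of_lt (by omega)] at this
        simp at this
  have h1 := key n le_rfl
  rw [Fin.natCast_eq_last, hc.step (Fin.last n), Fin.last_add_one] at h1
  have h2 : ∏ i, ψ (c i) = ∏ i ∈ Finset.range (n + 1), ψ (c (i : Fin (n + 1))) := by
    rw [← Fin.prod_univ_eq_prod_range (fun i => ψ (c (i : Fin (n + 1))))]
    simp
  rw [h2, Finset.prod_range_succ', h1]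
  simp
  ring

end Cycles
end SerreGraph

namespace SerreGraph

open Matrix

/-! ### Determinants and cycles -/

section Weights

variable {X : SerreGraph.{u}}

/-- Removing the first edges of simple cycles in different components does not disconnect any
vertices. -/
theorem joined_removeCycleEdges {F : Set X.E} {L : Set (X.Component F)} {n : L → ℕ}
    {c : ∀ C : L, Fin (n C + 1) → X.H} (hc : ∀ C, IsSimpleCycle C.1.subgraph (n C) (c C))
    {a b : X.V} (hab : X.Joined F a b) :
    X.Joined (F ∪ Set.range fun C : L => X.edge (c C 0)) a b := by
  set F' := F ∪ Set.range fun C : L => X.edge (c C 0) with hF'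
  have hinj : ∀ C C' : L, ∀ i, X.edge (c C i) = X.edge (c C' 0) → C = C' := by
    intro C C' i h
    have h1 := ((hc C).mem i).2
    have h2 := ((hc C').mem 0).2
    have h3 := ((hc C').mem 0).1
    apply Subtype.ext
    rw [← h1, ← h2]
    rcases X.edge_eq_edge_iff.1 h with h4 | h4
    · rw [h4]
    · rw [h4, component_root_inv h3]
  open Fin.NatCast in
  have hcycle : ∀ C : L, X.Joined F' (X.root (X.inv (c C 0))) (X.root (c C 0)) := by
    intro C
    have key : ∀ i ≤ n C, X.Joined F' (X.root (X.inv (c C 0)))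
        (X.root (X.inv (c C (i : Fin (n C + 1))))) := by
      intro i
      induction i with
      | zero =>
        intro _
        simp only [Nat.cast_zero]
        exact Relation.ReflTransGen.refl
      | succ i ih =>
        intro hi
        refine (ih (by omega)).tail ⟨c C ((i + 1 : ℕ) : Fin (n C + 1)), ?_, ?_, rfl⟩
        · rintro (h | ⟨C', h⟩)
          · exact ((hc C).mem _).1 h
          · have h1 := hinj C C' _ h.symm
            subst h1
            have h2 := congrArg Fin.val ((hc C).edge_injective h)
            rw [Fin.val_natCast, Nat.mod_eq_of_lt (by omega)] at h2
            simp at h2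
        · rw [(hc C).step]
          simp
    have := key (n C) le_rfl
    rwa [Fin.natCast_eq_last, (hc C).step (Fin.last _), Fin.last_add_one] at this
  induction hab with
  | refl => exact Relation.ReflTransGen.refl
  | tail _ hbc ih =>
    refine ih.trans ?_
    obtain ⟨h, hF, rfl, rfl⟩ := hbc
    by_cases hE : ∃ C : L, X.edge (c C 0) = X.edge h
    · obtain ⟨C, hC⟩ := hE
      rcases X.edge_eq_edge_iff.1 hC with h1 | h1
      · rw [← h1]
        exact (hcycle C).symm
      · have h2 : h = X.inv (c C 0) := by rw [h1, X.inv_inv]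
        rw [h2, X.inv_inv]
        exact hcycle C
    · refine Relation.ReflTransGen.single ⟨h, ?_, rfl, rfl⟩
      rintro (h1 | h1)
      · exact hF h1
      · exact hE h1

/-- Splitting off the range of an injective family from a subtype. -/
noncomputable def splitRange {α L : Type*} {P Q : α → Prop} (t : L → α)
    (ht : Function.Injective t) (htP : ∀ l, P (t l))
    (hQ : ∀ a, Q a ↔ P a ∧ a ∉ Set.range t) : {a // Q a} ⊕ L ≃ {a // P a} :=
  Equiv.ofBijective (Sum.elim (fun a => ⟨a.1, ((hQ a.1).1 a.2).1⟩) fun l => ⟨t l, htP l⟩) (by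
    constructor
    · rintro (a | l) (b | k) hab
      · exact congrArg Sum.inl (Subtype.ext (by have h := congrArg Subtype.val hab; exact h))
      · exact absurd ⟨k, (congrArg Subtype.val hab).symm⟩ ((hQ a.1).1 a.2).2
      · exact absurd ⟨l, congrArg Subtype.val hab⟩ ((hQ b.1).1 b.2).2
      · exact congrArg Sum.inr (ht (show t l = t k from congrArg Subtype.val hab))
    · rintro ⟨a, ha⟩
      by_cases h : a ∈ Set.range t
      · obtain ⟨l, rfl⟩ := h
        exact ⟨Sum.inr l, rfl⟩
      · exact ⟨Sum.inl ⟨a, (hQ a).2 ⟨ha, h⟩⟩, rfl⟩)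

open Classical in
/-- The determinant of a square twisted coboundary matrix, in terms of one simple cycle in each
component of `X \ F` that is contained in `W`.  Removing an edge of each of these cycles and one
of its endpoints leaves a rooted spanning forest, whose gauge clears the removed columns. -/
theorem absDet_coboundaryOn {ψ : X.H → ℂ} (hψ : IsGain ψ) (hn : ∀ h, ‖ψ h‖ = 1) {F : Set X.E}
    {W : Set X.V} (hcard : Nonempty ({v // v ∈ W} ≃ {e // e ∉ F})) {L : Set (X.Component F)}
    (hL : ∀ C, C ∈ L ↔ ∀ v, X.component F v = C → v ∈ W) {n : L → ℕ}
    {c : ∀ C : L, Fin (n C + 1) → X.H} (hc : ∀ C, IsSimpleCycle C.1.subgraph (n C) (c C)) :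
    (coboundaryOn ψ F W).absDet = ∏ C : L, ‖1 - ∏ i, ψ (c C i)‖ := by
  set r : L → X.V := fun C => X.root (c C 0) with hr
  set t : L → X.E := fun C => X.edge (c C 0) with ht
  have hrC : ∀ C, X.component F (r C) = C.1 := fun C => ((hc C).mem 0).2
  have htF : ∀ C, t C ∉ F := fun C => ((hc C).mem 0).1
  have hrinj : Function.Injective r := by
    intro C C' h
    apply Subtype.ext
    rw [← hrC, ← hrC, h]
  have htC : ∀ C, X.component F (X.root (X.orient (t C))) = C.1 := by
    intro C
    rcases X.orient_edge (c C 0) with h | h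
    · rw [ht]; simp only [h]; exact hrC C
    · rw [ht]; simp only [h]; rw [component_root_inv (htF C)]; exact hrC C
  have htC' : ∀ C, X.component F (X.root (X.inv (X.orient (t C)))) = C.1 := by
    intro C
    rw [component_root_inv (by rw [X.edge_orient]; exact htF C), htC]
  have htinj : Function.Injective t := by
    intro C C' h
    apply Subtype.ext
    rw [← htC, ← htC, h]
  have hrW : ∀ C, r C ∈ W := fun C => (hL C.1).1 C.2 _ (hrC C)
  set F' := F ∪ Set.range t with hF'
  set W' := W \ Set.range r with hW'
  let eR : {e // e ∉ F'} ⊕ L ≃ {e // e ∉ F} := splitRange t htinj htF (by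
    intro e
    simp only [hF', Set.mem_union, not_or])
  let eC : {v // v ∈ W'} ⊕ L ≃ {v // v ∈ W} := splitRange r hrinj hrW (fun v => Iff.rfl)
  have hcard' : Nonempty ({v // v ∈ W'} ≃ {e // e ∉ F'}) := by
    obtain ⟨e⟩ := hcard
    have h1 := Fintype.card_congr ((eC.trans e).trans eR.symm)
    rw [Fintype.card_sum, Fintype.card_sum, add_left_inj] at h1
    exact ⟨Fintype.equivOfCardEq h1⟩
  have hroot : ∀ v, ∃ d ∉ W', X.Joined F' v d := by
    intro v
    by_cases hv : X.component F v ∈ L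
    · refine ⟨r ⟨_, hv⟩, fun h => h.2 ⟨_, rfl⟩, joined_removeCycleEdges hc ?_⟩
      rw [← component_eq_iff, hrC]
    · rw [hL] at hv
      push Not at hv
      obtain ⟨d, hd, hdW⟩ := hv
      exact ⟨d, fun h => hdW h.1, joined_removeCycleEdges hc (component_eq_iff.1 hd.symm)⟩
  obtain ⟨hU, g, hg, hgn⟩ := exists_gauge hψ hn hroot hcard'
  have hg0 : ∀ v, g v ≠ 0 := fun v => norm_ne_zero_iff.1 (by rw [hgn]; exact one_ne_zero)
  -- the gauge on one component, normalized to be `1` at the chosen vertex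
  set γ : L → X.V → ℂ := fun C v => if X.component F v = C.1 then g v / g (r C) else 0 with hγ
  have hγr : ∀ C, γ C (r C) = 1 := by
    intro C
    simp only [hγ, hrC, if_true]
    exact div_self (hg0 _)
  have hγr' : ∀ C C', C' ≠ C → γ C (r C') = 0 := by
    intro C C' h
    simp only [hγ, hrC]
    exact if_neg fun h1 => h (Subtype.ext h1)
  have hγW : ∀ C, ∀ v ∉ W, γ C v = 0 := by
    intro C v hv
    simp only [hγ]
    exact if_neg fun h1 => hv ((hL C.1).1 C.2 v h1)
  have hγflat : ∀ C, IsFlat ψ F' (γ C) := by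
    intro C h hh
    have h1 : X.edge h ∉ F := fun h1 => hh (Or.inl h1)
    simp only [hγ, component_root_inv h1]
    split_ifs
    · rw [hg h hh, mul_div_assoc]
    · simp
  have hcol : ∀ (φ : X.V → ℂ) (C : L),
      ∑ v : {v // v ∈ W'}, φ v.1 * γ C v.1 + φ (r C) = ∑ v, φ v * γ C v := by
    intro φ C
    have h1 : ∑ v : {v // v ∈ W}, φ v.1 * γ C v.1 = ∑ v, φ v * γ C v :=
      Fintype.sum_of_injective Subtype.val Subtype.val_injective _ _
        (fun v hv => by rw [hγW C v (by simpa using hv), mul_zero]) fun _ => rfl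
    rw [← h1, ← Equiv.sum_comp eC, Fintype.sum_sum_type]
    congr 1
    have h2 : ∀ C', φ (eC (Sum.inr C')).1 * γ C (eC (Sum.inr C')).1 = φ (r C') * γ C (r C') :=
      fun _ => rfl
    simp only [h2]
    rw [Finset.sum_eq_single C, hγr, mul_one]
    · intro C' _ h
      rw [hγr' C C' h, mul_zero]
    · simp
  rw [← Matrix.absDet_submatrix _ eR eC]
  let G : Matrix {v // v ∈ W'} L ℂ := Matrix.of fun v C => γ C v.1
  let M₁ : Matrix L {v // v ∈ W'} ℂ := Matrix.of fun C v => coboundary ψ (t C) v.1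
  let M₂ : Matrix L L ℂ := Matrix.of fun C C' => coboundary ψ (t C) (r C')
  have hblock : (coboundaryOn ψ F W).submatrix eR eC =
      Matrix.fromBlocks (coboundaryOn ψ F' W')
        (Matrix.of fun e C => coboundary ψ e.1 (r C))
        M₁ M₂ := by
    ext (i | i) (j | j) <;> rfl
  rw [hblock, Matrix.absDet_fromBlocks _ _ _ _ hcard' G, hU, one_mul]
  · have hdiag : M₁ * G + M₂ = Matrix.diagonal fun C => (coboundary ψ *ᵥ γ C) (t C) := by
      ext C C'
      rw [Matrix.add_apply, Matrix.mul_apply]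
      simp only [M₁, M₂, G, Matrix.of_apply]
      rw [hcol (fun v => coboundary ψ (t C) v) C']
      by_cases h : C = C'
      · subst h
        rw [Matrix.diagonal_apply_eq]
        rfl
      · rw [Matrix.diagonal_apply_ne _ h]
        have h2 : ¬ C.1 = C'.1 := fun h1 => h (Subtype.ext h1)
        change (coboundary ψ *ᵥ γ C') (t C) = 0
        rw [coboundary_mulVec]
        simp [hγ, htC, htC', h2]
    rw [hdiag, Matrix.det_diagonal, norm_prod]
    refine Finset.prod_congr rfl fun C _ => ?_
    have htr := (hc C).transport (ψ := ψ) (f := γ C) (by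
      intro i hi
      refine hγflat C _ ?_
      rintro (h | ⟨C', h⟩)
      · exact ((hc C).mem i).1 h
      · have h1 : C' = C := by
          apply Subtype.ext
          have h2 := (hc C).mem i
          rw [← h2.2, ← hrC]
          rcases X.edge_eq_edge_iff.1 h with h4 | h4
          · rw [hr]; simp only [h4]
          · rw [hr]; simp only [h4]; rw [component_root_inv h2.1]
        subst h1
        exact hi ((hc C').edge_injective h.symm))
    have h3 : γ C (X.root (c C 0)) = 1 := hγr C
    rw [h3, mul_one] at htr
    rw [coboundary_mulVec]
    rcases X.orient_edge (c C 0) with h | h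
    · simp only [ht, h]
      rw [h3, htr]
    · simp only [ht, h]
      rw [X.inv_inv, h3, mul_one, ← one_mul ‖1 - _‖, ← hn (X.inv (c C 0)), ← norm_mul,
        ← norm_neg, ← htr]
      congr 1
      linear_combination (γ C (X.root (X.inv (c C 0)))) * hψ (c C 0)
  · ext e C
    rw [Matrix.add_apply, Matrix.mul_apply]
    have h1 := hcol (fun v => coboundary ψ e.1 v) C
    refine h1.trans ?_
    exact (isFlat_iff_coboundary_mulVec hψ F' (γ C)).1 (hγflat C) e.1 e.2

end Weights
end SerreGraph

namespace SerreGraph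

open Matrix

/-! ### Isomorphisms of covers -/

/-- The inverse of an isomorphism of covers. -/
def GCover.Iso.symm {G : Type w} [Group G] {X₁ : SerreGraph.{u₁}} {X₂ : SerreGraph.{u₂}}
    {X : SerreGraph.{u}} {p : GCover G X₁ X} {q : GCover G X₂ X} (I : p.Iso q) : q.Iso p where
  eV := I.eV.symm
  eH := I.eH.symm
  map_inv h := by rw [Equiv.symm_apply_eq, I.map_inv, Equiv.apply_symm_apply]
  map_root h := by rw [Equiv.symm_apply_eq, I.map_root, Equiv.apply_symm_apply]
  mapV g x := by rw [Equiv.symm_apply_eq, I.mapV, Equiv.apply_symm_apply]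
  mapH g h := by rw [Equiv.symm_apply_eq, I.mapH, Equiv.apply_symm_apply]
  overV x := by rw [← I.overV, Equiv.apply_symm_apply]
  overH h := by rw [← I.overH, Equiv.apply_symm_apply]

/-! ### Twisted independent sets and flat functions -/

section Twisted

variable {G : Type w} [CommGroup G] {X : SerreGraph.{u}} (D : X.V → Subgroup G)
  (ρ : G →* ℂˣ) (η : X.H → G)

/-- The gain function of a character and a voltage assignment. -/
def gain : X.H → ℂ := fun h => (ρ (η h) : ℂ)

/-- The vertices on whose dilation groups the character is trivial. -/
def undilated : Set X.V := {v | (D v).map ρ = ⊥}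

theorem mem_undilated_iff {v : X.V} : v ∈ undilated D ρ ↔ ∀ d ∈ D v, ρ d = 1 := by
  rw [undilated, Set.mem_ofPred_eq, Subgroup.map_eq_bot_iff]
  rfl

variable {η}

theorem isGain_gain (hη : X.IsVoltage η) : IsGain (gain ρ η) := by
  intro h
  rw [gain, gain, hη, ← Units.val_mul, ← map_mul, mul_inv_cancel, map_one, Units.val_one]

theorem norm_character [Finite G] (g : G) : ‖(ρ g : ℂ)‖ = 1 := by
  refine Complex.norm_eq_one_of_pow_eq_one (n := Nat.card G) ?_ Nat.card_pos.ne'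
  rw [← Units.val_pow_eq_pow_val, ← map_pow, pow_card_eq_one', map_one, Units.val_one]

theorem norm_gain [Finite G] (h : X.H) : ‖gain ρ η h‖ = 1 := norm_character ρ _

theorem gain_inv [Finite G] (hη : X.IsVoltage η) (h : X.H) :
    gain ρ η (X.inv h) = star (gain ρ η h) := by
  have h1 : gain ρ η (X.inv h) = (gain ρ η h)⁻¹ := by
    rw [gain, gain, hη, map_inv, Units.val_inv_eq_inv_val]
  rw [h1, Complex.inv_eq_conj (norm_gain ρ h)]
  rfl

variable [Finite G]

/-- A flat function that does not vanish on a component trivializes the twisted cover there. -/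
theorem nonempty_iso_trivial_of_flat (hη : X.IsVoltage η) {F : Set X.E} {f : X.V → ℂ}
    (hfW : ∀ v ∉ undilated D ρ, f v = 0) (hf : IsFlat (gain ρ η) F f) {v₀ : X.V}
    (h0 : f v₀ ≠ 0) :
    Nonempty (((X.twistedCover D ρ η hη).restrict (X.component F v₀).subgraph).Iso
      (trivialCover ρ.range (X.component F v₀).subgraph.toGraph)) := by
  have hne : ∀ v, X.component F v = X.component F v₀ → f v ≠ 0 := fun v hv h =>
    h0 ((hf.eq_zero_iff (isGain_gain ρ hη) (component_eq_iff.1 hv)).1 h)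
  have hbot : ∀ v, X.component F v = X.component F v₀ → ∀ d ∈ D v, ρ d = 1 := by
    intro v hv
    rw [← mem_undilated_iff]
    by_contra h
    exact hne v hv (hfW v h)
  have hex : ∀ v, X.component F v = X.component F v₀ →
      ∃ γ : ρ.range, f v₀ = ((γ : ℂˣ) : ℂ) * f v := by
    intro v hv
    have hj : X.Joined F v₀ v := (component_eq_iff.1 hv).symm
    clear hv
    induction hj with
    | refl => exact ⟨1, by simp⟩
    | tail _ hbc ih =>
      obtain ⟨h, hF, rfl, rfl⟩ := hbc
      obtain ⟨γ, hγ⟩ := ih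
      refine ⟨γ * ρ.rangeRestrict (η h), ?_⟩
      rw [hγ, hf h hF, ← mul_assoc]
      rfl
  -- on the component, `f` has its values in one coset of `ρ(G)`, and `s` is the section to be found
  choose! s hs using hex
  have hstep : ∀ h, X.edge h ∉ F → X.component F (X.root h) = X.component F v₀ →
      s (X.root (X.inv h)) = s (X.root h) * ρ.rangeRestrict (η h) := by
    intro h hF hC
    have hC' : X.component F (X.root (X.inv h)) = X.component F v₀ := by
      rw [component_root_inv hF, hC]
    have h1 := hs _ hC
    rw [hs _ hC', hf h hF, ← mul_assoc] at h1
    exact Subtype.ext (Units.ext (mul_right_cancel₀ (hne _ hC') h1))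
  let I : (trivialCover ρ.range (X.component F v₀).subgraph.toGraph).Iso
      ((X.twistedCover D ρ η hη).restrict (X.component F v₀).subgraph) :=
    { eV := Equiv.ofBijective
        (fun x => ⟨⟨x.1.1, QuotientGroup.mk (x.2 * s x.1.1)⟩, x.1.2⟩) (by
          constructor
          · rintro ⟨⟨v, hv⟩, a⟩ ⟨⟨v', hv'⟩, b⟩ hab
            have h1 := congrArg Subtype.val hab
            obtain ⟨h2, h3⟩ := Sigma.mk.inj h1
            obtain rfl : v = v' := h2
            have h4 := QuotientGroup.eq.1 (eq_of_heq h3)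
            obtain ⟨d, hd, hd'⟩ := h4
            have h5 : ρ.rangeRestrict d = 1 := Subtype.ext (hbot v hv d hd)
            rw [h5] at hd'
            have h6 := inv_mul_eq_one.1 hd'.symm
            exact Prod.ext rfl (mul_right_cancel h6)
          · rintro ⟨⟨v, q⟩, hv⟩
            obtain ⟨a, rfl⟩ := QuotientGroup.mk_surjective q
            refine ⟨(⟨v, hv⟩, a * (s v)⁻¹), ?_⟩
            simp only [inv_mul_cancel_right]
            rfl)
      eH := Equiv.ofBijective (fun k => ⟨(k.1.1, k.2 * s (X.root k.1.1)), k.1.2⟩) (by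
          constructor
          · rintro ⟨⟨h, hh⟩, a⟩ ⟨⟨h', hh'⟩, b⟩ hab
            have h1 := congrArg Subtype.val hab
            obtain ⟨h2, h3⟩ := Prod.mk.inj h1
            obtain rfl : h = h' := h2
            exact Prod.ext rfl (mul_right_cancel h3)
          · rintro ⟨⟨h, a⟩, hh⟩
            refine ⟨(⟨h, hh⟩, a * (s (X.root h))⁻¹), ?_⟩
            simp only [inv_mul_cancel_right]
            rfl)
      map_inv := by
        rintro ⟨⟨h, hh⟩, a⟩
        refine Subtype.ext (Prod.ext rfl ?_)
        change a * s (X.root (X.inv h)) = a * s (X.root h) * ρ.rangeRestrict (η h)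
        rw [hstep h hh.1 hh.2, mul_assoc]
      map_root := fun _ => rfl
      mapV := by
        rintro g ⟨⟨v, hv⟩, a⟩
        refine Subtype.ext (Sigma.ext rfl (heq_of_eq ?_))
        change QuotientGroup.mk (g * a * s v) = g • QuotientGroup.mk (a * s v)
        rw [mul_assoc]
        rfl
      mapH := by
        rintro g ⟨⟨h, hh⟩, a⟩
        exact Subtype.ext (Prod.ext rfl (mul_assoc _ _ _))
      overV := fun _ => rfl
      overH := fun _ => rfl }
  exact ⟨I.symm⟩

open Classical in
/-- A trivialization of the twisted cover on a component gives a flat function there. -/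
theorem exists_flat_of_iso_trivial (hη : X.IsVoltage η) {F : Set X.E} (C : X.Component F)
    (I : ((X.twistedCover D ρ η hη).restrict C.subgraph).Iso
      (trivialCover ρ.range C.subgraph.toGraph)) :
    ∃ f : X.V → ℂ, (∀ v ∉ undilated D ρ, f v = 0) ∧ IsFlat (gain ρ η) F f ∧ f ≠ 0 := by
  -- the base points of the fibers; their second coordinates under `I` are the values of `f`
  let x : ∀ v, X.component F v = C →
      (((X.twistedCover D ρ η hη).preimage C.subgraph).toGraph).V :=
    fun v hv => ⟨⟨v, QuotientGroup.mk 1⟩, hv⟩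
  set f : X.V → ℂ := fun v => if h : X.component F v = C then
    (((I.eV (x v h)).2 : ℂˣ) : ℂ) else 0 with hf
  refine ⟨f, fun v hv => ?_, fun h hF => ?_, fun h0 => ?_⟩
  · refine dif_neg fun hC => hv ?_
    rw [mem_undilated_iff]
    intro d hd
    have h1 := I.mapV (ρ.rangeRestrict d) (x v hC)
    have h2 : ((X.twistedCover D ρ η hη).restrict C.subgraph).actV (ρ.rangeRestrict d) (x v hC) =
        x v hC := by
      refine Subtype.ext (Sigma.ext rfl (heq_of_eq ?_))
      change QuotientGroup.mk (ρ.rangeRestrict d * 1) = QuotientGroup.mk 1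
      rw [mul_one]
      exact ((QuotientGroup.eq_one_iff (ρ.rangeRestrict d)).2 ⟨d, hd, rfl⟩)
    rw [h2] at h1
    have h3 : (I.eV (x v hC)).2 = ρ.rangeRestrict d * (I.eV (x v hC)).2 := congrArg Prod.snd h1
    exact congrArg Subtype.val (right_eq_mul.1 h3)
  · by_cases hC : X.component F (X.root h) = C
    · have hC' : X.component F (X.root (X.inv h)) = C := by rw [component_root_inv hF, hC]
      let k : (((X.twistedCover D ρ η hη).preimage C.subgraph).toGraph).H := ⟨(h, 1), hF, hC⟩
      have h1 := I.map_root k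
      have h2 := I.map_root (SerreGraph.inv _ k)
      rw [I.map_inv] at h2
      have h3 : SerreGraph.root _ k = x _ hC := rfl
      have h4 : SerreGraph.root _ (SerreGraph.inv _ k) =
          ((X.twistedCover D ρ η hη).restrict C.subgraph).actV (ρ.rangeRestrict (η h))
            (x _ hC') := by
        refine Subtype.ext (Sigma.ext rfl (heq_of_eq ?_))
        change QuotientGroup.mk (1 * ρ.rangeRestrict (η h)) =
          QuotientGroup.mk (ρ.rangeRestrict (η h) * 1)
        rw [one_mul, mul_one]
      rw [h3] at h1
      rw [h4, I.mapV] at h2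
      have h5 : (I.eV (x _ hC)).2 = (I.eH k).2 := congrArg Prod.snd h1
      have h6 : ρ.rangeRestrict (η h) * (I.eV (x _ hC')).2 = (I.eH k).2 := congrArg Prod.snd h2
      rw [hf]
      simp only [dif_pos hC, dif_pos hC']
      rw [h5, ← h6]
      rfl
    · have hC' : X.component F (X.root (X.inv h)) ≠ C := by rwa [component_root_inv hF]
      simp [hf, hC, hC']
  · obtain ⟨v, hv⟩ : ∃ v, X.component F v = C := Quotient.exists_rep C
    have h1 := congrFun h0 v
    rw [hf] at h1
    simp only [dif_pos hv, Pi.zero_apply] at h1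
    exact Units.ne_zero _ h1

/-- A set of edges is independent if and only if no nonzero function that vanishes on the vertices
with nontrivial dilation is flat outside of it. -/
theorem twistedIndep_iff (hη : X.IsVoltage η) (F : Set X.E) :
    X.TwistedIndep D ρ η hη F ↔
      ∀ f : X.V → ℂ, (∀ v ∉ undilated D ρ, f v = 0) → IsFlat (gain ρ η) F f → f = 0 := by
  constructor
  · intro h f hfW hf
    by_contra h0
    obtain ⟨v, hv⟩ := Function.ne_iff.1 h0
    obtain ⟨I⟩ := nonempty_iso_trivial_of_flat D ρ hη hfW hf hv
    exact (h (X.component F v)).false I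
  · intro h C
    refine ⟨fun I => ?_⟩
    obtain ⟨f, hfW, hf, h0⟩ := exists_flat_of_iso_trivial D ρ hη C I
    exact h0 (h f hfW hf)

open Classical in
/-- The twisted matroid is linear: it is represented by the images of the standard basis vectors
modulo the space of coboundaries. -/
theorem exists_matroid_twistedIndep (hη : X.IsVoltage η) (h0 : X.TwistedIndep D ρ η hη ∅) :
    ∃ M : Matroid X.E, M.E = Set.univ ∧
      ∀ F : Set X.E, M.Indep F ↔ X.TwistedIndep D ρ η hη F := by
  let U : Submodule ℂ (X.V → ℂ) :=
    { carrier := {f | ∀ v ∉ undilated D ρ, f v = 0}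
      zero_mem' := fun _ _ => rfl
      add_mem' := fun {a b} ha hb v hv => by rw [Pi.add_apply, ha v hv, hb v hv, add_zero]
      smul_mem' := fun c a ha v hv => by rw [Pi.smul_apply, ha v hv, smul_zero] }
  let B : Submodule ℂ (X.E → ℂ) := U.map (coboundary (gain ρ η)).mulVecLin
  obtain ⟨M, hME, hM⟩ := exists_matroid_linearIndepOn (K := ℂ)
    fun e : X.E => B.mkQ (Pi.single e 1)
  refine ⟨M, hME, fun F => ?_⟩
  rw [hM, linearIndepOn_iff, twistedIndep_iff]
  have hcomb : ∀ l : X.E →₀ ℂ,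
      Finsupp.linearCombination ℂ (fun e : X.E => B.mkQ (Pi.single e 1)) l = 0 ↔
        (l : X.E → ℂ) ∈ B := by
    intro l
    have h1 : ∑ e, l e • (Pi.single e 1 : X.E → ℂ) = l := by
      funext e
      simp [Finset.sum_apply, Pi.single_apply]
    rw [Finsupp.linearCombination_apply, Finsupp.sum_fintype _ _ (by simp)]
    simp only [← map_smul]
    rw [← map_sum, h1, Submodule.mkQ_apply, Submodule.Quotient.mk_eq_zero]
  rw [twistedIndep_iff] at h0
  constructor
  · intro h f hfW hf
    rw [isFlat_iff_coboundary_mulVec (isGain_gain ρ hη)] at hf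
    apply h0 f hfW
    rw [isFlat_iff_coboundary_mulVec (isGain_gain ρ hη)]
    have h1 := h (Finsupp.equivFunOnFinite.symm (coboundary (gain ρ η) *ᵥ f)) (by
      rw [Finsupp.mem_supported']
      intro e he
      exact hf e he) ((hcomb _).2 ⟨f, hfW, rfl⟩)
    intro e _
    exact DFunLike.congr_fun h1 e
  · intro h l hl hl0
    obtain ⟨f, hfW, hf⟩ := (hcomb l).1 hl0
    rw [Finsupp.mem_supported'] at hl
    have h1 : f = 0 := by
      refine h f hfW ?_
      rw [isFlat_iff_coboundary_mulVec (isGain_gain ρ hη)]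
      intro e he
      rw [← hl e he]
      exact congrFun hf e
    rw [h1, map_zero] at hf
    exact DFunLike.coe_injective hf.symm

open Classical in
/-- The bases are the complements of the bases of the rows of the coboundary matrix. -/
theorem twistedBasis_iff (hη : X.IsVoltage η) (F : Set X.E) :
    X.TwistedBasis D ρ η hη F ↔ (coboundaryOn (gain ρ η) F (undilated D ρ)).absDet ≠ 0 := by
  have hψ := isGain_gain ρ hη
  -- independence as injectivity of the coboundary matrix
  have hinj : ∀ F, X.TwistedIndep D ρ η hη F ↔ ∀ k : {v // v ∈ undilated D ρ} → ℂ,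
      coboundaryOn (gain ρ η) F (undilated D ρ) *ᵥ k = 0 → k = 0 := by
    intro F
    rw [twistedIndep_iff]
    constructor
    · intro h k hk
      set f : X.V → ℂ := fun v => if h : v ∈ undilated D ρ then k ⟨v, h⟩ else 0 with hf
      have hfW : ∀ v ∉ undilated D ρ, f v = 0 := fun v hv => dif_neg hv
      have hkf : k = fun v : {v // v ∈ undilated D ρ} => f v := by
        funext v
        simp [hf]
      have h1 := h f hfW (by
        rw [isFlat_iff_coboundary_mulVec hψ]
        intro e he
        rw [← coboundaryOn_mulVec (gain ρ η) F (undilated D ρ) hfW ⟨e, he⟩, ← hkf, hk]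
        rfl)
      rw [hkf, h1]
      rfl
    · intro h f hfW hf
      rw [isFlat_iff_coboundary_mulVec hψ] at hf
      have h1 := h (fun v => f v) (by
        funext e
        rw [coboundaryOn_mulVec _ _ _ hfW, hf e.1 e.2]
        rfl)
      funext v
      by_cases hv : v ∈ undilated D ρ
      · exact congrFun h1 ⟨v, hv⟩
      · exact hfW v hv
  rw [Matrix.absDet_ne_zero_iff, ← hinj]
  have hle : ∀ F, X.TwistedIndep D ρ η hη F →
      Fintype.card {v // v ∈ undilated D ρ} ≤ Fintype.card {e // e ∉ F} := by
    intro F hF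
    rw [hinj] at hF
    have h1 : Function.Injective (coboundaryOn (gain ρ η) F (undilated D ρ)).mulVecLin := by
      rw [← LinearMap.ker_eq_bot, LinearMap.ker_eq_bot']
      exact hF
    have := LinearMap.finrank_le_finrank_of_injective h1
    rwa [Module.finrank_fintype_fun_eq_card, Module.finrank_fintype_fun_eq_card] at this
  constructor
  · intro hF
    refine ⟨⟨Fintype.equivOfCardEq ((hle F hF.prop).antisymm ?_)⟩, hF.prop⟩
    by_contra hlt
    rw [not_le] at hlt
    -- a row that occurs in a linear relation can be removed
    have hker : LinearMap.ker (coboundaryOn (gain ρ η) F (undilated D ρ)).vecMulLinear ≠ ⊥ := by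
      refine LinearMap.ker_ne_bot_of_finrank_lt ?_
      rwa [Module.finrank_fintype_fun_eq_card, Module.finrank_fintype_fun_eq_card]
    obtain ⟨c, hc, hc0⟩ := Submodule.exists_mem_ne_zero_of_ne_bot hker
    obtain ⟨e, he⟩ := Function.ne_iff.1 hc0
    have hc' : c ᵥ* coboundaryOn (gain ρ η) F (undilated D ρ) = 0 := hc
    have hins : X.TwistedIndep D ρ η hη (insert e.1 F) := by
      rw [twistedIndep_iff]
      intro f hfW hf
      refine (twistedIndep_iff D ρ hη F).1 hF.prop f hfW ?_
      rw [isFlat_iff_coboundary_mulVec hψ] at hf ⊢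
      have h1 : c ⬝ᵥ (coboundaryOn (gain ρ η) F (undilated D ρ) *ᵥ fun v => f v) = 0 := by
        rw [Matrix.dotProduct_mulVec, hc', zero_dotProduct]
      rw [dotProduct, Finset.sum_eq_single e] at h1
      · rw [coboundaryOn_mulVec _ _ _ hfW] at h1
        have h2 := (mul_eq_zero.1 h1).resolve_left he
        intro e' he'
        by_cases hee : e' = e.1
        · rw [hee, h2]
        · exact hf e' (by simp [hee, he'])
      · intro e' _ hee
        rw [coboundaryOn_mulVec _ _ _ hfW, hf e'.1, mul_zero]
        rintro (h | h)
        · exact hee (Subtype.ext h)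
        · exact e'.2 h
      · simp
    exact e.2 (hF.le_of_ge hins (Set.subset_insert _ _) (Set.mem_insert _ _))
  · rintro ⟨⟨e⟩, hF⟩
    refine ⟨hF, fun F' hF' hFF' => ?_⟩
    intro a ha
    by_contra haF
    have h1 := hle F' hF'
    rw [Fintype.card_congr e] at h1
    have h2 : Fintype.card {e // e ∉ F'} < Fintype.card {e // e ∉ F} :=
      Fintype.card_lt_of_injective_of_notMem
        (fun x : {e // e ∉ F'} => (⟨x.1, fun h => x.2 (hFF' h)⟩ : {e // e ∉ F}))
        (fun x y hxy => Subtype.ext (congrArg (fun z : {e // e ∉ F} => z.1) hxy))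
        (b := ⟨a, haF⟩) (by
          rintro ⟨x, hx⟩
          have h3 : x.1 = a := congrArg Subtype.val hx
          exact x.2 (h3 ▸ ha))
    omega

end Twisted
end SerreGraph

namespace SerreGraph

open Matrix

/-! ### The weight polynomial as a determinant -/

section JacobianPolynomial

open Classical in
theorem prod_mul_prod_compl_inv {α : Type*} [Fintype α] {x : α → ℝ} (hx : ∀ e, x e ≠ 0)
    (F : Finset α) : (∏ e, (x e : ℂ)) * ∏ e ∈ Fᶜ, (x e : ℂ)⁻¹ = ∏ e ∈ F, (x e : ℂ) := by
  rw [← Finset.prod_mul_prod_compl F fun e => (x e : ℂ), mul_assoc, ← Finset.prod_mul_distrib]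
  rw [Finset.prod_eq_one (s := Fᶜ), mul_one]
  intro e _
  exact mul_inv_cancel₀ (Complex.ofReal_ne_zero.2 (hx e))

open Classical in
theorem eval_jacobianPoly (X : SerreGraph.{u}) {x : X.E → ℝ} (hx : ∀ e, x e ≠ 0) :
    ((MvPolynomial.eval x (MvPolynomial.map (Int.castRingHom ℝ) X.jacobianPoly) : ℝ) : ℂ) =
      (∏ e, (x e : ℂ)) * ∑ T ∈ Finset.filter (fun T : Finset X.E =>
        (X.spanning (T : Set X.E)).toGraph.IsTree) Finset.univ, ∏ e ∈ T, (x e : ℂ)⁻¹ := by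
  rw [jacobianPoly, map_sum, map_sum, Complex.ofReal_sum, Finset.mul_sum]
  refine Finset.sum_congr rfl fun T _ => ?_
  have h := prod_mul_prod_compl_inv hx Tᶜ
  rw [compl_compl] at h
  rw [h]
  simp [map_prod]

end JacobianPolynomial

section WeightPolynomial

variable {G : Type w} [CommGroup G] {X : SerreGraph.{u}} (D : X.V → Subgroup G)
  (ρ : G →* ℂˣ) {η : X.H → G} [Finite G]

open Classical in
/-- The weight of a basis is the square of the corresponding maximal minor. -/
theorem basisWeight_eq (hη : X.IsVoltage η) {F : Set X.E} (hF : X.TwistedBasis D ρ η hη F) :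
    X.basisWeight D ρ η F = (coboundaryOn (gain ρ η) F (undilated D ρ)).absDet ^ 2 := by
  have hψ := isGain_gain ρ hη
  have hdet := (twistedBasis_iff D ρ hη F).1 hF
  have hcard := ((Matrix.absDet_ne_zero_iff _).1 hdet).1
  set L : Set (X.Component F) := {C | ∀ v, X.component F v = C → v ∈ undilated D ρ} with hL
  have hcyc : ∀ C : L, ∃ n c, IsSimpleCycle (X := X) C.1.subgraph n c ∧
      X.frobenius η C.1.subgraph = ∏ i, η (c i) := by
    intro C
    have hex : ∃ a, X.IsCycleVoltage η C.1.subgraph a := by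
      obtain ⟨n, c, hc⟩ := exists_simpleCycle_component hψ C.1 (by
        intro f hfC hf
        refine (twistedIndep_iff D ρ hη F).1 hF.prop f (fun v hv => hfC v fun h => ?_) hf
        exact hv (C.2 v h))
      exact ⟨_, n, c, hc.mem, hc.step, hc.root_injective, hc.edge_injective, rfl⟩
    obtain ⟨n, c, h1, h2, h3, h4, h5⟩ := hex.choose_spec
    refine ⟨n, c, ⟨h1, h2, h3, h4⟩, ?_⟩
    rw [frobenius, dif_pos hex]
    exact h5
  choose n c hc hfrob using hcyc
  rw [absDet_coboundaryOn hψ (norm_gain ρ) hcard (fun _ => Iff.rfl) hc, ← Finset.prod_pow,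
    basisWeight]
  symm
  refine Fintype.prod_of_injective Subtype.val Subtype.val_injective _ _ (fun C hC => ?_)
    fun C => ?_
  · rw [componentWeight, if_neg]
    intro h
    exact hC ⟨⟨C, h⟩, rfl⟩
  · have h1 : ∀ v ∈ C.1.subgraph.verts, (D v).map ρ = ⊥ := C.2
    rw [componentWeight, if_pos h1, hfrob]
    simp [gain, map_prod]

open Classical in
theorem eval_weightPoly (hη : X.IsVoltage η) {x : X.E → ℝ} (hx : ∀ e, x e ≠ 0) :
    ((MvPolynomial.eval x (X.weightPoly D ρ η hη) : ℝ) : ℂ) =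
      (∏ e, (x e : ℂ)) * ((laplacian (gain ρ η) fun e => (x e : ℂ)⁻¹).submatrix
        (Subtype.val : {v // v ∈ undilated D ρ} → X.V) Subtype.val).det := by
  set N : Matrix X.E {v // v ∈ undilated D ρ} ℂ :=
    (coboundary (gain ρ η)).submatrix id Subtype.val with hN
  have h1 : (laplacian (gain ρ η) fun e => (x e : ℂ)⁻¹).submatrix
      (Subtype.val : {v // v ∈ undilated D ρ} → X.V) Subtype.val =
      Nᴴ * Matrix.diagonal (fun e => (x e : ℂ)⁻¹) * N := by
    ext a b
    simp [laplacian, hN, Matrix.mul_apply, Matrix.submatrix_apply, Matrix.conjTranspose_apply]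
  rw [h1, Matrix.det_conjTranspose_mul_diagonal_mul, weightPoly, map_sum, Complex.ofReal_sum,
    Finset.mul_sum, ← (compl_bijective (α := Finset X.E)).sum_comp, Finset.sum_filter]
  refine Finset.sum_congr rfl fun F _ => ?_
  have h2 : (N.submatrix (Subtype.val : {e // e ∈ Fᶜ} → X.E) id).absDet =
      (coboundaryOn (gain ρ η) (F : Set X.E) (undilated D ρ)).absDet := by
    rw [← Matrix.absDet_submatrix (coboundaryOn (gain ρ η) (F : Set X.E) (undilated D ρ))
      (Equiv.subtypeEquivRight (by simp) : {e // e ∈ Fᶜ} ≃ {e // e ∉ (F : Set X.E)})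
      (Equiv.refl _)]
    rfl
  rw [h2, ← mul_assoc, prod_mul_prod_compl_inv hx]
  split_ifs with hF
  · rw [← basisWeight_eq D ρ hη hF, map_mul, MvPolynomial.eval_C, map_prod, mul_comm]
    simp
  · rw [twistedBasis_iff, not_not] at hF
    simp [hF]

end WeightPolynomial
end SerreGraph

namespace SerreGraph

open Matrix

/-! ### Voltage assignments of covers -/

section Voltage

variable {G : Type w} [CommGroup G] {X' : SerreGraph.{v}} {X : SerreGraph.{u}}
  (p : GCover G X' X)

/-- Since the group is abelian, the dilation group of a vertex is the stabilizer of any point of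
the fiber. -/
theorem GCover.mem_dilation_of_actV_eq {g : G} {x : X'.V} (h : p.actV g x = x) :
    g ∈ p.dilation (p.onV x) := by
  intro y hy
  obtain ⟨a, rfl⟩ := p.transitiveV x y hy.symm
  rw [← p.mul_actV, mul_comm, p.mul_actV, h]

theorem GCover.exists_root_eq {x : X'.V} {h : X.H} (hx : X.root h = p.onV x) :
    ∃ k, X'.root k = x ∧ p.onH k = h := by
  have h1 := p.deg_pos x
  rw [p.balancing x h hx, Nat.card_pos_iff] at h1
  obtain ⟨⟨k, hk⟩⟩ := h1.1
  exact ⟨k, hk⟩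

theorem apply_out_eq {D : Subgroup G} {ρ : G →* ℂˣ} (h : ∀ d ∈ D, ρ d = 1) (g : G) :
    ρ (QuotientGroup.mk g : G ⧸ D).out = ρ g := by
  obtain ⟨d, hd⟩ := QuotientGroup.mk_out_eq_mul D g
  rw [hd, map_mul, h _ d.2, mul_one]

variable [Finite G]

theorem GCover.exists_onV_eq (v : X.V) : ∃ x, p.onV x = v := by
  by_contra! h
  have : IsEmpty {x : X'.V // p.onV x = v} := ⟨fun x => h x.1 x.2⟩
  have h1 := p.degree v
  rw [finsum_of_isEmpty] at h1
  exact Nat.card_pos.ne h1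

/-- Every cover comes from a voltage assignment, which compares chosen base points of the fibers
over the two orientations of each edge. -/
theorem GCover.exists_hasVoltage :
    ∃ (η : X.H → G) (hη : X.IsVoltage η), p.HasVoltage η hη := by
  choose x hx using p.exists_onV_eq
  have hk : ∀ h, ∃ k, X'.root k = x (X.root h) ∧ p.onH k = h :=
    fun h => p.exists_root_eq (hx _).symm
  choose k hk hk' using hk
  have hη : ∀ h, ∃ g, p.actH g (k (X.inv h)) = X'.inv (k h) := by
    intro h
    refine p.transitiveH _ _ ?_
    rw [hk', p.map_inv, hk']
  choose η hη using hη
  have hvolt : X.IsVoltage η := by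
    intro h
    rw [eq_inv_iff_mul_eq_one, mul_comm]
    refine p.freeH _ (k h) ?_
    have h1 := hη (X.inv h)
    rw [X.inv_inv] at h1
    rw [p.mul_actH, h1, p.act_inv, hη, X'.inv_inv]
  -- the coset of `g` over `v` corresponds to the translate by `g` of the base point `x v`
  have hact : ∀ a b (y : X'.V), p.actV a y = p.actV b y ↔ p.actV (a⁻¹ * b) y = y := by
    intro a b y
    constructor
    · intro h
      rw [p.mul_actV, ← h, ← p.mul_actV, inv_mul_cancel, p.one_actV]
    · intro h
      conv_lhs => rw [← h]
      rw [← p.mul_actV, mul_inv_cancel_left]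
  let φ : (X.coverGraph p.dilation η hvolt).V → X'.V := fun y =>
    Quotient.liftOn' y.2 (fun g => p.actV g (x y.1)) (by
      intro a b hab
      rw [QuotientGroup.leftRel_apply] at hab
      exact (hact a b _).2 (hab _ (hx _)))
  have hφ : ∀ v g, φ ⟨v, QuotientGroup.mk g⟩ = p.actV g (x v) := fun _ _ => rfl
  have hφ' : ∀ y, p.onV (φ y) = y.1 := by
    rintro ⟨v, q⟩
    obtain ⟨g, rfl⟩ := QuotientGroup.mk_surjective q
    rw [hφ, p.equivariantV, hx]
  let I : (X.voltageCover p.dilation η hvolt).Iso p :=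
    { eV := Equiv.ofBijective φ (by
        constructor
        · intro y z hyz
          have h1 : y.1 = z.1 := by rw [← hφ', hyz, hφ']
          obtain ⟨v, q⟩ := y
          obtain ⟨v', q'⟩ := z
          obtain rfl : v = v' := h1
          obtain ⟨a, rfl⟩ := QuotientGroup.mk_surjective q
          obtain ⟨b, rfl⟩ := QuotientGroup.mk_surjective q'
          rw [hφ, hφ, hact] at hyz
          have h2 := p.mem_dilation_of_actV_eq hyz
          rw [hx] at h2
          rw [QuotientGroup.eq.2 h2]
        · intro y
          obtain ⟨g, hg⟩ := p.transitiveV (x (p.onV y)) y (hx _)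
          exact ⟨⟨p.onV y, QuotientGroup.mk g⟩, hg⟩)
      eH := Equiv.ofBijective (fun l : X.H × G => p.actH l.2 (k l.1)) (by
        constructor
        · rintro ⟨h, a⟩ ⟨h', b⟩ hab
          have h1 : h = h' := by
            have := congrArg p.onH hab
            simpa only [p.equivariantH, hk'] using this
          subst h1
          refine Prod.ext rfl (inv_mul_eq_one.1 (p.freeH _ (k h) ?_))
          have h2 : p.actH a (k h) = p.actH b (k h) := hab
          rw [p.mul_actH, ← h2, ← p.mul_actH, inv_mul_cancel, p.one_actH]
        · intro l
          obtain ⟨g, hg⟩ := p.transitiveH (k (p.onH l)) l (hk' _)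
          exact ⟨(p.onH l, g), hg⟩)
      map_inv := by
        rintro ⟨h, g⟩
        change p.actH (g * η h) (k (X.inv h)) = X'.inv (p.actH g (k h))
        rw [p.mul_actH, hη, p.act_inv]
      map_root := by
        rintro ⟨h, g⟩
        change p.actV g (x (X.root h)) = X'.root (p.actH g (k h))
        rw [← hk, p.act_root]
      mapV := by
        rintro g ⟨v, q⟩
        obtain ⟨a, rfl⟩ := QuotientGroup.mk_surjective q
        change p.actV (g * a) (x v) = p.actV g (p.actV a (x v))
        rw [p.mul_actV]
      mapH := by
        rintro g ⟨h, a⟩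
        exact p.mul_actH g a (k h)
      overV := hφ'
      overH := by
        rintro ⟨h, a⟩
        change p.onH (p.actH a (k h)) = h
        rw [p.equivariantH, hk'] }
  exact ⟨η, hvolt, ⟨I.symm⟩⟩

/-- If the total space is connected, the empty set is independent for every nontrivial character:
a flat function lifts to a locally constant function on the total space. -/
theorem GCover.twistedIndep_empty (hX' : X'.Connected) {η : X.H → G} {hη : X.IsVoltage η}
    (hp : p.HasVoltage η hη) {ρ : G →* ℂˣ} (hρ : ρ ≠ 1) :
    X.TwistedIndep p.dilation ρ η hη ∅ := by
  obtain ⟨I⟩ := hp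
  rw [twistedIndep_iff]
  intro f hfW hf
  let lift : (X.coverGraph p.dilation η hη).V → ℂ := fun y => f y.1 * ρ y.2.out
  have hlift : ∀ v g, lift ⟨v, QuotientGroup.mk g⟩ = f v * ρ g := by
    intro v g
    by_cases hv : v ∈ undilated p.dilation ρ
    · rw [mem_undilated_iff] at hv
      change f v * _ = _
      rw [apply_out_eq hv]
    · change f v * _ = _
      rw [hfW v hv, zero_mul, zero_mul]
  have hconst : ∀ a b, X'.Joined ∅ a b → lift (I.eV a) = lift (I.eV b) := by
    intro a b hab
    induction hab with
    | refl => rfl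
    | tail _ hbc ih =>
      obtain ⟨h, -, rfl, rfl⟩ := hbc
      rw [ih, I.map_root, I.map_root, I.map_inv]
      obtain ⟨k, g⟩ := I.eH h
      change lift ⟨X.root k, QuotientGroup.mk g⟩ =
        lift ⟨X.root (X.inv k), QuotientGroup.mk (g * η k)⟩
      rw [hlift, hlift, hf k (Set.notMem_empty _), map_mul, Units.val_mul, gain]
      ring
  obtain ⟨g, hg⟩ : ∃ g, ρ g ≠ 1 := by
    by_contra! h
    exact hρ (MonoidHom.ext h)
  funext v
  let y : G → (X.coverGraph p.dilation η hη).V := fun g => ⟨v, QuotientGroup.mk g⟩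
  have h1 := hconst (I.eV.symm (y g)) (I.eV.symm (y 1)) (hX'.2 _ _)
  rw [Equiv.apply_symm_apply, Equiv.apply_symm_apply, hlift, hlift, map_one, Units.val_one,
    mul_one] at h1
  by_contra h0
  exact hg (Units.ext ((mul_eq_left₀ h0).1 h1))

/-- The product over the edges of the total space of a function on the edges of the base. -/
theorem GCover.prod_onE {η : X.H → G} {hη : X.IsVoltage η} (hp : p.HasVoltage η hη)
    (f : X.E → ℂ) : ∏ e, f (p.toHom.onE e) = (∏ e, f e) ^ Nat.card G := by
  classical
  obtain ⟨I⟩ := hp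
  have hmap : ∀ h, p.toHom.onE (X'.edge h) = X.edge (p.onH h) := fun _ => rfl
  have hfib : ∀ e, (Finset.univ.filter fun e' => p.toHom.onE e' = e).card = Nat.card G := by
    intro e
    rw [← Fintype.card_subtype, ← Nat.card_eq_fintype_card]
    symm
    let k : G → (X.coverGraph p.dilation η hη).H := fun g => (X.orient e, g)
    refine Nat.card_congr (Equiv.ofBijective
      (fun g => ⟨X'.edge (I.eH.symm (k g)), ?_⟩) ⟨?_, ?_⟩)
    · rw [hmap, ← I.overH, Equiv.apply_symm_apply]
      exact X.edge_orient e
    · intro a b hab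
      rcases X'.edge_eq_edge_iff.1 (congrArg Subtype.val hab) with h | h
      · exact congrArg Prod.snd (I.eH.symm.injective h)
      · have h1 := congrArg I.eH h
        rw [I.map_inv, Equiv.apply_symm_apply, Equiv.apply_symm_apply] at h1
        exact absurd (congrArg Prod.fst h1).symm (X.inv_ne _)
    · rintro ⟨e', he'⟩
      have h1 : ∃ h, X'.edge h = e' ∧ p.onH h = X.orient e := by
        have h2 := he'
        rw [← X'.edge_orient e', hmap, ← X.edge_orient e] at h2
        rcases X.edge_eq_edge_iff.1 h2 with h3 | h3
        · exact ⟨_, X'.edge_orient e', h3⟩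
        · refine ⟨X'.inv (X'.orient e'), by rw [X'.edge_inv, X'.edge_orient], ?_⟩
          rw [p.map_inv, h3, X.inv_inv]
      obtain ⟨h, rfl, hh⟩ := h1
      refine ⟨(I.eH h).2, Subtype.ext ?_⟩
      have h4 : k (I.eH h).2 = I.eH h := Prod.ext (hh.symm.trans (I.overH h).symm) rfl
      change X'.edge (I.eH.symm (k (I.eH h).2)) = X'.edge h
      rw [h4, Equiv.symm_apply_apply]
  rw [← Finset.prod_fiberwise Finset.univ p.toHom.onE, ← Finset.prod_pow]
  refine Finset.prod_congr rfl fun e _ => ?_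
  rw [Finset.prod_congr rfl (g := fun _ => f e), Finset.prod_const, hfib]
  intro e' he'
  rw [(Finset.mem_filter.1 he').2]

end Voltage
end SerreGraph

namespace SerreGraph

open Matrix

/-! ### Character sums -/

section CharacterSums

variable {G : Type w} [CommGroup G]

open Classical in
theorem sum_character [Fintype G] (ρ : G →* ℂˣ) :
    ∑ g, (ρ g : ℂ) = if ρ = 1 then (Nat.card G : ℂ) else 0 := by
  have h := sum_hom_units ((Units.coeHom ℂ).comp ρ)
  have h1 : (Units.coeHom ℂ).comp ρ = 1 ↔ ρ = 1 := by
    constructor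
    · intro h
      ext g
      exact DFunLike.congr_fun h g
    · rintro rfl
      rfl
  rw [Nat.card_eq_fintype_card]
  simp only [h1] at h
  refine Eq.trans ?_ (h.trans ?_)
  · rfl
  · split_ifs <;> simp

open Classical in
/-- The sum of a character over a coset. -/
theorem sum_character_coset [Fintype G] (D : Subgroup G) (ρ : G →* ℂˣ) (g : G) :
    ∑ a : G, (if (QuotientGroup.mk a : G ⧸ D) = QuotientGroup.mk g then (ρ a : ℂ) else 0) =
      if ∀ d ∈ D, ρ d = 1 then (Nat.card D : ℂ) * ρ g else 0 := by
  have h1 : ∑ a : G, (if (QuotientGroup.mk a : G ⧸ D) = QuotientGroup.mk g then (ρ a : ℂ) else 0) =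
      ∑ d : D, (ρ g : ℂ) * (ρ.comp D.subtype d : ℂ) := by
    symm
    refine Fintype.sum_of_injective (fun d : D => g * d.1)
      (fun a b h => Subtype.ext (mul_left_cancel h)) _ _ (fun a ha => ?_) fun d => ?_
    · refine if_neg fun h => ha ⟨⟨g⁻¹ * a, QuotientGroup.eq.1 h.symm⟩, ?_⟩
      exact mul_inv_cancel_left g a
    · rw [if_pos (QuotientGroup.mk_mul_of_mem g d.2), map_mul, Units.val_mul]
      rfl
  rw [h1, ← Finset.mul_sum, sum_character]
  have h2 : ρ.comp D.subtype = 1 ↔ ∀ d ∈ D, ρ d = 1 := by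
    constructor
    · intro h d hd
      exact DFunLike.congr_fun h ⟨d, hd⟩
    · intro h
      ext d
      exact congrArg Units.val (h d.1 d.2)
  simp only [h2]
  split_ifs <;> ring

open Classical in
/-- The sum over a quotient of a character that is trivial on the subgroup. -/
theorem card_mul_sum_character_out [Finite G] (D : Subgroup G) [Fintype (G ⧸ D)] {ρ : G →* ℂˣ}
    (h : ∀ d ∈ D, ρ d = 1) : (Nat.card D : ℂ) * ∑ q : G ⧸ D, (ρ q.out : ℂ) =
      if ρ = 1 then (Nat.card G : ℂ) else 0 := by
  have := Fintype.ofFinite G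
  have h0 := sum_character ρ
  have h1 : ∀ q : G ⧸ D, (Nat.card D : ℂ) * ρ q.out =
      ∑ a : G, if (QuotientGroup.mk a : G ⧸ D) = q then (ρ a : ℂ) else 0 := by
    intro q
    have h2 := sum_character_coset D ρ q.out
    rw [if_pos h] at h2
    rw [← h2]
    refine Finset.sum_congr rfl fun a _ => ?_
    rw [QuotientGroup.out_eq']
  rw [Finset.mul_sum, Finset.sum_congr rfl fun q _ => h1 q, Finset.sum_comm]
  simp only [Finset.sum_ite_eq, Finset.mem_univ, if_true]
  rw [h0]
  split_ifs <;> rfl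

noncomputable instance [Finite G] : Fintype (G →* ℂˣ) := Fintype.ofFinite _

theorem card_characters_trivial_on [Finite G] (D : Subgroup G) :
    Nat.card {ρ : G →* ℂˣ // ∀ d ∈ D, ρ d = 1} = Nat.card (G ⧸ D) := by
  rw [← CommGroup.card_domRestrictHom_ker ℂ D]
  refine Nat.card_congr (Equiv.subtypeEquivRight fun ρ => ?_)
  rw [MonoidHom.mem_ker]
  constructor
  · intro h
    ext d
    exact congrArg Units.val (h d.1 d.2)
  · intro h d hd
    exact DFunLike.congr_fun h ⟨d, hd⟩

end CharacterSums

/-! ### Fourier decomposition of the Laplacian of a cover -/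

section Fourier

open Classical in
theorem laplacian_mulVec {X : SerreGraph.{u}} {ψ : X.H → ℂ}
    (hψ : ∀ h, ψ (X.inv h) = star (ψ h)) (hn : ∀ h, ‖ψ h‖ = 1) (y : X.E → ℂ) (f : X.V → ℂ)
    (a : X.V) : (laplacian ψ y *ᵥ f) a = ∑ h : X.H, if X.root h = a then
      y (X.edge h) * (f a - ψ h * f (X.root (X.inv h))) else 0 := by
  simp only [Matrix.mulVec, dotProduct, laplacian_apply hψ hn, Finset.sum_mul]
  rw [Finset.sum_comm]
  refine Finset.sum_congr rfl fun h _ => ?_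
  split_ifs
  · simp [mul_sub, sub_mul, Finset.sum_sub_distrib, mul_assoc]
  · simp

open Classical in
/-- The Laplacians of isomorphic covers agree. -/
theorem GCover.Iso.laplacian_eq {G : Type w} [Group G] {X₁ : SerreGraph.{u₁}}
    {X₂ : SerreGraph.{u₂}} {X : SerreGraph.{u}} {p : GCover G X₁ X} {q : GCover G X₂ X}
    (I : p.Iso q) (y : X.E → ℂ) :
    laplacian (1 : X₁.H → ℂ) (fun e => y (p.toHom.onE e)) =
      (laplacian (1 : X₂.H → ℂ) fun e => y (q.toHom.onE e)).submatrix I.eV I.eV := by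
  ext a b
  rw [Matrix.submatrix_apply, laplacian_apply (by simp) (by simp),
    laplacian_apply (by simp) (by simp), ← Equiv.sum_comp I.eH]
  refine Finset.sum_congr rfl fun h _ => ?_
  have h1 : q.toHom.onE (X₂.edge (I.eH h)) = p.toHom.onE (X₁.edge h) :=
    congrArg X.edge (I.overH h)
  simp only [h1, ← I.map_root, ← I.map_inv, EmbeddingLike.apply_eq_iff_eq, Pi.one_apply]

variable {G : Type w} [CommGroup G] [Finite G] (X : SerreGraph.{u}) (D : X.V → Subgroup G)
  {η : X.H → G} (hη : X.IsVoltage η)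

/-- The indices of the Fourier basis: a character, and a vertex on whose dilation group it is
trivial. -/
abbrev FourierIndex : Type (max u w) := Σ ρ : G →* ℂˣ, {v // v ∈ undilated D ρ}

/-- The vertices of the cover, as pairs of a vertex of the base and a coset.  It is the identity map
and separates the two types, so that instances are found for the plain sigma type. -/
def coverVertex : (Σ v : X.V, G ⧸ D v) ≃ (X.coverGraph D η hη).V := Equiv.refl _

open Classical in
/-- The Fourier basis: the function `(v, [g]) ↦ ρ g` on the fiber over one vertex, extended by
zero.  The chosen representative of a coset does not matter, as `ρ` is trivial on `D v`. -/
noncomputable def fourierMatrix : Matrix (Σ v : X.V, G ⧸ D v) (X.FourierIndex D) ℂ :=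
  Matrix.of fun x j => if x.1 = j.2.1 then (j.1 x.2.out : ℂ) else 0

/-- The Laplacian of the cover, with conductances from the base, plus the rank one matrix `m mᵀ`
where `m` is the local degree function `(v, [g]) ↦ |D(v)|`. -/
noncomputable def coverLaplacian (y : X.E → ℂ) :
    Matrix (Σ v : X.V, G ⧸ D v) (Σ v : X.V, G ⧸ D v) ℂ :=
  (laplacian (1 : (X.coverGraph D η hη).H → ℂ)
    (fun e => y ((X.voltageCover D η hη).toHom.onE e))).submatrix
      (X.coverVertex D hη) (X.coverVertex D hη) +
  Matrix.of fun a b => (Nat.card (D a.1) : ℂ) * Nat.card (D b.1)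

noncomputable instance : Fintype (Σ v : X.V, G ⧸ D v) := Fintype.ofFinite _

noncomputable instance : Fintype (X.FourierIndex D) := Fintype.ofFinite _

open Classical in
/-- The block of the character `ρ` in the matrix of `coverLaplacian` in the Fourier basis.  The
rank one term contributes only to the trivial character. -/
noncomputable def fourierLaplacian (η : X.H → G) (y : X.E → ℂ) (ρ : G →* ℂˣ) :
    Matrix {v // v ∈ undilated D ρ} {v // v ∈ undilated D ρ} ℂ :=
  Matrix.diagonal (fun a => (Nat.card (D a.1) : ℂ)) *
    ((laplacian (gain ρ η) y).submatrix Subtype.val Subtype.val +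
      Matrix.of fun _ _ => if ρ = 1 then (Nat.card G : ℂ) else 0)

theorem card_fourierIndex :
    Fintype.card (Σ v : X.V, G ⧸ D v) = Fintype.card (X.FourierIndex D) := by
  have h1 : Nat.card (X.FourierIndex D) =
      Nat.card (Σ v : X.V, {ρ : G →* ℂˣ // v ∈ undilated D ρ}) :=
    Nat.card_congr
      { toFun := fun j => ⟨j.2.1, j.1, j.2.2⟩
        invFun := fun j => ⟨j.2.1, j.1, j.2.2⟩
        left_inv := fun _ => rfl
        right_inv := fun _ => rfl }
  rw [← Nat.card_eq_fintype_card, ← Nat.card_eq_fintype_card, h1, Nat.card_sigma,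
    Nat.card_sigma]
  refine Finset.sum_congr rfl fun v _ => ?_
  rw [← card_characters_trivial_on]
  exact Nat.card_congr (Equiv.subtypeEquivRight fun ρ => (mem_undilated_iff D ρ).symm)

end Fourier
end SerreGraph

namespace SerreGraph

open Matrix

section FourierDet

variable {G : Type w} [CommGroup G] (X : SerreGraph.{u}) (D : X.V → Subgroup G)
  {η : X.H → G} (hη : X.IsVoltage η)

theorem fourierMatrix_mk (v : X.V) (g : G) (j : X.FourierIndex D) [Decidable (v = j.2.1)] :
    X.fourierMatrix D ⟨v, QuotientGroup.mk g⟩ j = if v = j.2.1 then (j.1 g : ℂ) else 0 := by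
  obtain ⟨ρ, b, hb⟩ := j
  rw [fourierMatrix, Matrix.of_apply]
  by_cases h : v = b
  · subst h
    rw [if_pos rfl, if_pos rfl, apply_out_eq ((mem_undilated_iff D ρ).1 hb)]
  · rw [if_neg h, if_neg h]

variable [Finite G]

open Classical in
/-- The action of the Laplacian of the cover on the Fourier basis. -/
theorem laplacian_mulVec_fourierMatrix (y : X.E → ℂ) (v : X.V) (g : G) (j : X.FourierIndex D) :
    (laplacian (1 : (X.coverGraph D η hη).H → ℂ)
      (fun e => y ((X.voltageCover D η hη).toHom.onE e)) *ᵥ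
        fun x => X.fourierMatrix D ((X.coverVertex D hη).symm x) j)
          (X.coverVertex D hη ⟨v, QuotientGroup.mk g⟩) =
      (if v ∈ undilated D j.1 then (Nat.card (D v) : ℂ) * j.1 g else 0) *
        laplacian (gain j.1 η) y v j.2.1 := by
  have := Fintype.ofFinite G
  have hif : (if v ∈ undilated D j.1 then (Nat.card (D v) : ℂ) * j.1 g else 0) =
      ∑ a : G, (if (QuotientGroup.mk a : G ⧸ D v) = QuotientGroup.mk g
        then (j.1 a : ℂ) else 0) := by
    rw [sum_character_coset]
    simp only [mem_undilated_iff]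
  rw [hif, laplacian_mulVec (by simp) (by simp),
    laplacian_apply (gain_inv j.1 hη) (norm_gain j.1), Finset.sum_mul_sum,
    ← Finset.sum_product', Finset.univ_product_univ]
  let e : G × X.H ≃ (X.coverGraph D η hη).H := Equiv.prodComm G X.H
  refine (Fintype.sum_equiv e _ _ ?_).symm
  rintro ⟨a, h⟩
  change _ = @ite ℂ
    ((⟨X.root h, QuotientGroup.mk a⟩ : Σ v : X.V, G ⧸ D v) = ⟨v, QuotientGroup.mk g⟩)
    (Classical.propDecidable _)
    (y (X.edge h) * (X.fourierMatrix D ⟨v, QuotientGroup.mk g⟩ j -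
      1 * X.fourierMatrix D ⟨X.root (X.inv h), QuotientGroup.mk (a * η h)⟩ j)) 0
  dsimp only
  by_cases hv : X.root h = v
  · subst hv
    by_cases ha : (QuotientGroup.mk a : G ⧸ D (X.root h)) = QuotientGroup.mk g
    · rw [← ha, if_pos rfl, if_pos rfl, if_pos rfl, fourierMatrix_mk, fourierMatrix_mk, gain,
        map_mul, Units.val_mul]
      split_ifs <;> ring
    · rw [if_neg ha, zero_mul]
      refine (if_neg fun h1 => ha ?_).symm
      exact eq_of_heq (Sigma.mk.inj h1).2
  · rw [if_neg hv, mul_zero, mul_zero]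
    refine (if_neg fun h1 => hv ?_).symm
    exact (Sigma.mk.inj h1).1

theorem sum_cosets {M : Type*} [AddCommMonoid M] (f : (Σ v : X.V, G ⧸ D v) → M)
    [∀ v, Fintype (G ⧸ D v)] :
    ∑ x, f x = ∑ v, ∑ q : G ⧸ D v, f ⟨v, q⟩ := by
  rw [← Fintype.sum_sigma']
  congr!

open Classical in
/-- The mass of the elements of the Fourier basis. -/
theorem sum_mass_fourierMatrix (j : X.FourierIndex D) :
    ∑ x, (Nat.card (D x.1) : ℂ) * X.fourierMatrix D x j =
      if j.1 = 1 then (Nat.card G : ℂ) else 0 := by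
  have := fun v => Fintype.ofFinite (G ⧸ D v)
  obtain ⟨ρ, b, hb⟩ := j
  rw [sum_cosets]
  simp only [fourierMatrix, Matrix.of_apply]
  rw [Finset.sum_eq_single b]
  · simp only [if_true]
    rw [← Finset.mul_sum, card_mul_sum_character_out _ ((mem_undilated_iff D ρ).1 hb)]
  · intro v _ hv
    simp [hv]
  · simp

open Classical in
/-- The Fourier basis is orthogonal. -/
theorem fourierMatrix_conjTranspose_mul :
    (X.fourierMatrix D)ᴴ * X.fourierMatrix D = Matrix.diagonal fun j =>
      (Nat.card G : ℂ) / Nat.card (D j.2.1) := by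
  have := fun v => Fintype.ofFinite (G ⧸ D v)
  ext ⟨ρ, a, ha⟩ ⟨σ, b, hb⟩
  rw [Matrix.mul_apply, sum_cosets]
  simp only [Matrix.conjTranspose_apply, fourierMatrix, Matrix.of_apply]
  rw [Finset.sum_eq_single a]
  · simp only [if_true]
    by_cases hab : a = b
    · subst hab
      simp only [if_true]
      have h2 : ∀ q : G ⧸ D a, star (ρ q.out : ℂ) * (σ q.out : ℂ) = ((ρ⁻¹ * σ) q.out : ℂˣ) := by
        intro q
        rw [MonoidHom.mul_apply, MonoidHom.inv_apply, Units.val_mul, Units.val_inv_eq_inv_val,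
          Complex.inv_eq_conj (norm_character ρ _)]
        rfl
      rw [Finset.sum_congr rfl fun q _ => h2 q]
      have hcard : (Nat.card (D a) : ℂ) ≠ 0 := Nat.cast_ne_zero.2 Nat.card_pos.ne'
      have h3 := card_mul_sum_character_out (D a) (ρ := ρ⁻¹ * σ) (by
        intro d hd
        rw [MonoidHom.mul_apply, MonoidHom.inv_apply, (mem_undilated_iff D ρ).1 ha d hd,
          (mem_undilated_iff D σ).1 hb d hd, inv_one, mul_one])
      by_cases hρ : ρ = σ
      · subst hρ
        rw [if_pos (inv_mul_cancel ρ)] at h3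
        rw [Matrix.diagonal_apply_eq, eq_div_iff hcard, mul_comm, h3]
      · rw [if_neg (fun h => hρ (inv_mul_eq_one.1 h)), mul_eq_zero] at h3
        rw [Matrix.diagonal_apply_ne, h3.resolve_left hcard]
        intro h4
        exact hρ (Sigma.mk.inj h4).1
    · rw [Matrix.diagonal_apply_ne]
      · simp [hab]
      · intro h4
        injection h4 with h5 h6
        subst h5
        exact hab (congrArg Subtype.val (eq_of_heq h6))
  · intro v _ hv
    simp [hv]
  · simp

open Classical in
/-- The Fourier basis block diagonalizes the Laplacian of the cover. -/
theorem coverLaplacian_mul_fourierMatrix (y : X.E → ℂ) :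
    X.coverLaplacian D hη y * X.fourierMatrix D =
      X.fourierMatrix D * Matrix.blockDiagonal' (X.fourierLaplacian D η y) := by
  ext ⟨v, q⟩ j
  obtain ⟨g, rfl⟩ := QuotientGroup.mk_surjective q
  have h1 : (X.coverLaplacian D hη y * X.fourierMatrix D) ⟨v, QuotientGroup.mk g⟩ j =
      (laplacian (1 : (X.coverGraph D η hη).H → ℂ)
        (fun e => y ((X.voltageCover D η hη).toHom.onE e)) *ᵥ
          fun x => X.fourierMatrix D ((X.coverVertex D hη).symm x) j)
            (X.coverVertex D hη ⟨v, QuotientGroup.mk g⟩) +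
      (Nat.card (D v) : ℂ) * ∑ x, (Nat.card (D x.1) : ℂ) * X.fourierMatrix D x j := by
    rw [coverLaplacian, Matrix.add_mul, Matrix.add_apply, Matrix.mul_apply, Matrix.mul_apply,
      Finset.mul_sum, Matrix.mulVec, dotProduct, ← Equiv.sum_comp (X.coverVertex D hη)]
    congr 1
    refine Finset.sum_congr rfl fun x _ => ?_
    rw [← mul_assoc]
    rfl
  rw [h1, laplacian_mulVec_fourierMatrix, sum_mass_fourierMatrix, Matrix.mul_apply]
  obtain ⟨ρ, b⟩ := j
  have hsig : ∀ F : X.FourierIndex D → ℂ, ∑ j, F j =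
      ∑ ρ, ∑ a : {v // v ∈ undilated D ρ}, F ⟨ρ, a⟩ := by
    intro F
    rw [← Fintype.sum_sigma']
    congr!
  rw [hsig, Finset.sum_eq_single ρ]
  · by_cases hv : v ∈ undilated D ρ
    · rw [Finset.sum_eq_single ⟨v, hv⟩]
      · rw [if_pos hv, fourierMatrix_mk, if_pos rfl, Matrix.blockDiagonal'_apply_eq,
          fourierLaplacian, Matrix.diagonal_mul, Matrix.add_apply, Matrix.submatrix_apply,
          Matrix.of_apply]
        by_cases hρ : ρ = 1
        · subst hρ
          simp
          ring
        · simp only [hρ, if_false]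
          ring
      · intro a _ ha
        rw [fourierMatrix_mk, if_neg, zero_mul]
        intro h
        exact ha (Subtype.ext h.symm)
      · simp
    · have hρ : ρ ≠ 1 := by
        rintro rfl
        exact hv ((mem_undilated_iff D 1).2 fun _ _ => rfl)
      rw [if_neg hv, if_neg hρ, Finset.sum_eq_zero]
      · simp
      · intro a _
        rw [fourierMatrix_mk, if_neg, zero_mul]
        rintro rfl
        exact hv a.2
  · intro σ _ hσ
    refine Finset.sum_eq_zero fun a _ => ?_
    rw [Matrix.blockDiagonal'_apply_ne _ _ _ hσ, mul_zero]
  · simp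

/-- The determinant of a block diagonal matrix with blocks of different sizes. -/
theorem det_blockDiagonal' {o : Type*} {n : o → Type*} [Fintype o] [DecidableEq o]
    [∀ i, Fintype (n i)] [∀ i, DecidableEq (n i)] [Fintype (Σ i, n i)] [DecidableEq (Σ i, n i)]
    (M : ∀ i, Matrix (n i) (n i) ℂ) : (Matrix.blockDiagonal' M).det = ∏ i, (M i).det := by
  let _ : LinearOrder o := LinearOrder.lift' (Fintype.equivFin o) (Equiv.injective _)
  have h : (Matrix.blockDiagonal' M).BlockTriangular Sigma.fst := by
    rintro ⟨i, a⟩ ⟨j, b⟩ hij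
    exact Matrix.blockDiagonal'_apply_ne _ _ _ (ne_of_gt hij)
  rw [h.det_fintype]
  refine Finset.prod_congr rfl fun i _ => ?_
  rw [← Matrix.det_submatrix_equiv_self (Equiv.sigmaSubtype i).symm]
  congr 1
  ext a b
  exact Matrix.blockDiagonal'_apply_eq _ _ _ _

open Classical in
/-- The determinant of the Laplacian of a cover is the product of its Fourier components. -/
theorem det_coverLaplacian (y : X.E → ℂ) :
    (X.coverLaplacian D hη y).det = ∏ ρ : G →* ℂˣ, (X.fourierLaplacian D η y ρ).det := by
  have hne : ∀ j : X.FourierIndex D, (Nat.card G : ℂ) / Nat.card (D j.2.1) ≠ 0 := fun j =>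
    div_ne_zero (Nat.cast_ne_zero.2 Nat.card_pos.ne') (Nat.cast_ne_zero.2 Nat.card_pos.ne')
  set U := X.fourierMatrix D with hU
  let d : Matrix (X.FourierIndex D) (X.FourierIndex D) ℂ :=
    Matrix.diagonal fun j => ((Nat.card G : ℂ) / Nat.card (D j.2.1))⁻¹
  have hVU : (d * Uᴴ) * U = 1 := by
    rw [Matrix.mul_assoc, fourierMatrix_conjTranspose_mul, Matrix.diagonal_mul_diagonal,
      ← Matrix.diagonal_one]
    congr 1
    funext j
    exact inv_mul_cancel₀ (hne j)
  have hUV : U * (d * Uᴴ) = 1 :=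
    (Matrix.mul_eq_one_comm_of_equiv (Fintype.equivOfCardEq (X.card_fourierIndex D).symm)).1 hVU
  rw [← det_blockDiagonal', ← Matrix.det_conj_of_mul_eq_one hVU hUV, Matrix.mul_assoc,
    coverLaplacian_mul_fourierMatrix, ← Matrix.mul_assoc, hVU, Matrix.one_mul]

end FourierDet
end SerreGraph

namespace SerreGraph

open Matrix

/-! ### The factorization of the Jacobian polynomial -/

section Factorization

variable {G : Type w} [CommGroup G] {X : SerreGraph.{u}} (D : X.V → Subgroup G)
  {η : X.H → G}

open Classical in
theorem det_fourierLaplacian_of_ne_one (y : X.E → ℂ) {ρ : G →* ℂˣ} (hρ : ρ ≠ 1) :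
    (X.fourierLaplacian D η y ρ).det = (∏ a : {v // v ∈ undilated D ρ}, (Nat.card (D a.1) : ℂ)) *
      ((laplacian (gain ρ η) y).submatrix
        (Subtype.val : {v // v ∈ undilated D ρ} → X.V) Subtype.val).det := by
  rw [fourierLaplacian, Matrix.det_mul, Matrix.det_diagonal]
  congr 2
  ext a b
  simp [hρ]

open Classical in
/-- The Fourier component of the trivial character computes the spanning trees of the base. -/
theorem det_fourierLaplacian_one [Nonempty X.V] (y : X.E → ℂ) :
    (X.fourierLaplacian D η y 1).det =
      (∏ a : {v // v ∈ undilated D (1 : G →* ℂˣ)}, (Nat.card (D a.1) : ℂ)) *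
      ((Nat.card G : ℂ) * (Nat.card X.V : ℂ) ^ 2 * ∑ T ∈ Finset.filter (fun T : Finset X.E =>
        (X.spanning (T : Set X.E)).toGraph.IsTree) Finset.univ, ∏ e ∈ T, y e) := by
  have h1 : ∀ v, v ∈ undilated D (1 : G →* ℂˣ) := fun v =>
    (mem_undilated_iff D 1).2 fun _ _ => rfl
  have h2 := det_laplacian_add (X := X) (m := fun _ => 1) (fun _ => one_pos) (Nat.card G : ℂ) y
  rw [fourierLaplacian, Matrix.det_mul, Matrix.det_diagonal]
  congr 1
  have h3 : (Nat.card X.V : ℂ) = ((∑ _v : X.V, (1 : ℝ) : ℝ) : ℂ) := by simp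
  rw [h3, ← h2, ← Matrix.det_submatrix_equiv_self (Equiv.subtypeUnivEquiv h1)]
  congr 1
  ext a b
  have h4 : gain (1 : G →* ℂˣ) η = 1 := by
    funext h
    simp [gain]
  simp [h4]

variable [Finite G]

open Classical in
/-- There are `|G| / |D v|` characters that are trivial on `D v`. -/
theorem prod_card_dilation :
    ∏ ρ : G →* ℂˣ, ∏ a : {v // v ∈ undilated D ρ}, (Nat.card (D a.1) : ℂ) =
      ∏ v : X.V, (Nat.card (D v) : ℂ) ^ (Nat.card G / Nat.card (D v)) := by
  have h1 : ∀ ρ : G →* ℂˣ, ∏ a : {v // v ∈ undilated D ρ}, (Nat.card (D a.1) : ℂ) =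
      ∏ v, if v ∈ undilated D ρ then (Nat.card (D v) : ℂ) else 1 := by
    intro ρ
    refine Fintype.prod_of_injective Subtype.val Subtype.val_injective _ _ (fun v hv => ?_)
      fun a => (if_pos a.2).symm
    exact if_neg (by simpa using hv)
  rw [Finset.prod_congr rfl fun ρ _ => h1 ρ, Finset.prod_comm]
  refine Finset.prod_congr rfl fun v _ => ?_
  rw [Finset.prod_ite, Finset.prod_const_one, mul_one, Finset.prod_const]
  congr 1
  rw [Nat.div_eq_of_eq_mul_left Nat.card_pos (Subgroup.card_eq_card_quotient_mul_card_subgroup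
    (D v)), ← card_characters_trivial_on, ← Fintype.card_subtype, ← Nat.card_eq_fintype_card]
  exact Nat.card_congr (Equiv.subtypeEquivRight fun ρ => mem_undilated_iff D ρ)

variable {X' : SerreGraph.{v}} (p : GCover G X' X)

open Classical in
/-- The matrix-tree theorem for the total space, with conductances from the base. -/
theorem GCover.det_coverLaplacian [Nonempty X.V] {hη : X.IsVoltage η} (hp : p.HasVoltage η hη)
    (y : X.E → ℂ) : (X.coverLaplacian p.dilation hη y).det =
      ((Nat.card G : ℂ) * Nat.card X.V) ^ 2 * ∑ T ∈ Finset.filter (fun T : Finset X'.E =>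
        (X'.spanning (T : Set X'.E)).toGraph.IsTree) Finset.univ,
          ∏ e ∈ T, y (p.toHom.onE e) := by
  obtain ⟨I⟩ := hp
  have hne : Nonempty X'.V := by
    obtain ⟨v⟩ := ‹Nonempty X.V›
    obtain ⟨x, -⟩ := p.exists_onV_eq v
    exact ⟨x⟩
  -- the mass of a point over `v` is the order of the dilation group of `v`
  let e : X'.V ≃ Σ v : X.V, G ⧸ p.dilation v := I.eV.trans (X.coverVertex p.dilation hη).symm
  have h1 := det_laplacian_add (X := X') (m := fun x => Nat.card (p.dilation (e x).1))
    (fun x => Nat.cast_pos.2 Nat.card_pos) 1 (fun e => y (p.toHom.onE e))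
  rw [one_mul] at h1
  have hmass : ∑ x, (Nat.card (p.dilation (e x).1) : ℝ) = Nat.card G * Nat.card X.V := by
    have := fun v => Fintype.ofFinite (G ⧸ p.dilation v)
    rw [Equiv.sum_comp e fun z => (Nat.card (p.dilation z.1) : ℝ)]
    rw [X.sum_cosets p.dilation]
    simp only [Finset.sum_const, Finset.card_univ, nsmul_eq_mul]
    rw [Finset.sum_congr rfl fun v _ => show (Fintype.card (G ⧸ p.dilation v) : ℝ) *
      Nat.card (p.dilation v) = Nat.card G by
        rw [← Nat.card_eq_fintype_card, ← Nat.cast_mul,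
          ← Subgroup.card_eq_card_quotient_mul_card_subgroup]]
    simp [mul_comm]
  rw [hmass] at h1
  push_cast at h1
  rw [← h1, ← Matrix.det_submatrix_equiv_self e]
  congr 1
  rw [I.laplacian_eq y]
  ext a b
  simp [coverLaplacian, e]

end Factorization
end SerreGraph

theorem theorem4p2 {G : Type w} [CommGroup G] [Finite G] {X' : SerreGraph.{v}}
    {X : SerreGraph.{u}} (hX : X.Connected) (p : SerreGraph.GCover G X' X) :
    (∃ (η : X.H → G) (hη : X.IsVoltage η), p.HasVoltage η hη) ∧
    ∀ (η : X.H → G) (hη : X.IsVoltage η), p.HasVoltage η hη →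
      (X'.Connected → ∀ ρ : G →* ℂˣ, ρ ≠ 1 →
        ∃ M : Matroid X.E, M.E = Set.univ ∧
          ∀ F : Set X.E, M.Indep F ↔ X.TwistedIndep p.dilation ρ η hη F) ∧
      MvPolynomial.map (Int.castRingHom ℝ) p.specializedJacobian =
        MvPolynomial.C
            ((1 / (Nat.card G : ℝ)) *
              ∏ v : X.V, (Nat.card (p.dilation v) : ℝ) ^
                (Nat.card G / Nat.card (p.dilation v))) *
          MvPolynomial.map (Int.castRingHom ℝ) X.jacobianPoly *
          ∏ ρ ∈ SerreGraph.nontrivialCharacters G, X.weightPoly p.dilation ρ η hη := by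
  refine ⟨p.exists_hasVoltage, fun η hη hp => ⟨fun hX' ρ hρ =>
    SerreGraph.exists_matroid_twistedIndep _ ρ hη (p.twistedIndep_empty hX' hp hρ), ?_⟩⟩
  classical
  have : Nonempty X.V := hX.1
  -- both sides agree at all points with nonzero coordinates
  refine MvPolynomial.funext_set (fun _ => {0}ᶜ) (fun _ => (Set.finite_singleton 0).infinite_compl)
    fun x hx => ?_
  have hx : ∀ e, x e ≠ 0 := fun e => hx e (Set.mem_univ e)
  apply Complex.ofReal_injective
  set y : X.E → ℂ := fun e => (x e : ℂ)⁻¹ with hy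
  set q := ∏ e, (x e : ℂ) with hq
  have hN : (Nat.card G : ℂ) ≠ 0 := Nat.cast_ne_zero.2 Nat.card_pos.ne'
  have hV : (Nat.card X.V : ℂ) ≠ 0 := Nat.cast_ne_zero.2 Nat.card_pos.ne'
  have hchar : SerreGraph.nontrivialCharacters G = Finset.univ.erase (1 : G →* ℂˣ) := by
    ext ρ
    simp [SerreGraph.nontrivialCharacters]
  have hcardchar : (SerreGraph.nontrivialCharacters G).card + 1 = Nat.card G := by
    rw [hchar, Finset.card_erase_add_one (Finset.mem_univ _), Finset.card_univ,
      ← Nat.card_eq_fintype_card, CommGroup.card_monoidHom_of_hasEnoughRootsOfUnity]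
  -- the matrix-tree theorem for the total space and the Fourier decomposition
  have h1 := p.det_coverLaplacian hp y
  rw [X.det_coverLaplacian p.dilation hη, ← Finset.mul_prod_erase _ _ (Finset.mem_univ 1),
    SerreGraph.det_fourierLaplacian_one, Finset.prod_congr rfl fun ρ hρ =>
      SerreGraph.det_fourierLaplacian_of_ne_one p.dilation y (Finset.ne_of_mem_erase hρ),
    Finset.prod_mul_distrib, mul_mul_mul_comm, Finset.mul_prod_erase Finset.univ
      (fun ρ : G →* ℂˣ => ∏ a : {v // v ∈ SerreGraph.undilated p.dilation ρ},
        (Nat.card (p.dilation a.1) : ℂ)) (Finset.mem_univ 1),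
    SerreGraph.prod_card_dilation, ← hchar] at h1
  -- passing from products over trees to products over their complements
  have h2 := X'.eval_jacobianPoly (x := fun e => x (p.toHom.onE e)) fun e => hx _
  rw [p.prod_onE hp fun e => (x e : ℂ)] at h2
  have h3 : MvPolynomial.eval x (MvPolynomial.map (Int.castRingHom ℝ) p.specializedJacobian) =
      MvPolynomial.eval (fun e => x (p.toHom.onE e))
        (MvPolynomial.map (Int.castRingHom ℝ) X'.jacobianPoly) := by
    rw [SerreGraph.GCover.specializedJacobian, MvPolynomial.map_rename, MvPolynomial.eval_rename]
    rfl
  rw [h3, h2, map_mul, map_mul, MvPolynomial.eval_C, map_prod, Complex.ofReal_mul,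
    Complex.ofReal_mul, Complex.ofReal_prod, X.eval_jacobianPoly hx,
    Finset.prod_congr rfl fun ρ _ => SerreGraph.eval_weightPoly p.dilation ρ hη hx,
    Finset.prod_mul_distrib, Finset.prod_const]
  have hpow : q ^ Nat.card G = q ^ (SerreGraph.nontrivialCharacters G).card * q := by
    rw [← pow_succ, hcardchar]
  rw [hpow]
  push_cast
  -- `h1` with the factor `N |V|²` cancelled
  have halg : ∀ {a n k t d t' c : ℂ}, n ≠ 0 → k ≠ 0 → a * ((n * k ^ 2 * t) * d) =
      (n * k) ^ 2 * t' → c * q * t' = (1 / n * a) * (q * t) * (c * d) := by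
    intro a n k t d t' c hn hk h
    have ht : n * t' = a * (t * d) := by
      refine mul_left_cancel₀ (mul_ne_zero hn (pow_ne_zero 2 hk)) ?_
      linear_combination -h
    field_simp
    linear_combination c * q * ht
  exact halg hN hV h1
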